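/- Let $\Bbbk$ be a field of characteristic $0$. A left-unital complete dg pre-Lie algebra $(A,\mathrm d,\mathrm F,\star,1)$ is a homologically $\mathbb Z$-graded chain complex $(A,\mathrm d)$ (so $|\mathrm d|=-1$) with a bilinear degree-preserving product $\star$ for which $\mathrm d$ is a derivation and which satisfies $$(x\star y)\star z-x\star(y\star z)=(-1)^{|y||z|}\big((x\star z)\star y-x\star(z\star y)\big),$$ an element $1\in A_0$ with $\mathrm d1=0$ and $1\star x=x$ for all $x$, and decreasing filtrations $A_n=\mathrm F_0A_n\supset \mathrm F_1A_n\supset\cdots$ by subspaces with $\mathrm d(\mathrm F_rA_n)\subset \mathrm F_rA_{n-1}$, $\mathrm F_rA_i\star\mathrm F_sA_j\subset\mathrm F_{r+s}A_{i+j}$ and $A_n\cong\lim_r A_n/\mathrm F_rA_n$. Each $A_n$ carries the filtration topology, and infinite sums are limits in it. For $x\in A$ and $y_1,\dots,y_n\in A_0$ define the symmetric braces by $\{x;\}=x$ and $$\{x;y_1,\dots,y_n\}=\{x;y_1,\dots,y_{n-1}\}\star y_n-\sum_{i=1}^{n-1}\{x;y_1,\dots,y_i\star y_n,\dots,y_{n-1}\}.$$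 For $x\in A$ and $y\in \mathrm F_1A_0$ put $x\circledcirc(1+y)=\sum_{n\ge0}\frac1{n!}\{x;y,\dots,y\}$ (with $n$ entries $y$). For $\lambda\in \mathrm F_1A_0$ put $\exp(\lambda)=1+\sum_{n\ge1}\frac1{n!}\lambda^{\star n}$ with $\lambda^{\star n}=((\lambda\star\lambda)\star\cdots)\star\lambda$, and let the Magnus expansion $\Omega(\lambda)=\lambda-\frac12\lambda\star\lambda+\frac14\lambda\star(\lambda\star\lambda)+\frac1{12}(\lambda\star\lambda)\star\lambda+\cdots$ be the limit of the iteration $\omega_0=0$, $\omega_{r+1}=\sum_{m\ge0}\frac{B_m}{m!}\,\big(((\lambda\star\omega_r)\star\omega_r)\cdots\big)\star\omega_r$ (with $m$ factors $\omega_r$), where $B_m$ are the Bernoulli numbers with $B_1=-\frac12$. Let $\mathrm{BCH}(x,y)=\ln(\exp(x)\exp(y))$ be the Baker–Campbell–Hausdorff series in the free associative algebra, written in Dynkin's form, in which each word $w_1\cdots w_n$ in $x,y$ is replaced by $\frac1n[w_1,[w_2,[\cdots,w_n]]]$; for $x,y\in\mathrm F_1A_0$ it is evaluated with $[x,y]=x\star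 y-y\star x$. Maurer–Cartan elements are the $\alpha\in A_{-1}$ with $\mathrm d\alpha+\alpha\star\alpha=0$. Theorem. The homogeneous components of $\ln(\exp(x)\exp(y))$ are the images of those of its Dynkin form (so they are Lie elements), and for every left-unital complete dg pre-Lie algebra $A$ over $\Bbbk$: 1. The series $\mathrm{BCH}$ converges on $\mathrm F_1A_0$; $\Gamma=(\mathrm F_1A_0,\mathrm{BCH},0)$ and $\mathfrak G=(1+\mathrm F_1A_0,\circledcirc,1)$ are topological groups; and $\exp:\Gamma\to\mathfrak G$ is an isomorphism of topological groups with inverse $1+\lambda\mapsto\Omega(\lambda)$. 2. The group $\mathfrak G$ acts (on the left, continuously) on the set of Maurer–Cartan elements by $$(1+\lambda)\cdot\alpha=\big((1+\lambda)\star\alpha\big)\circledcirc(1+\lambda)^{-1}-\mathrm d\lambda\circledcirc(1+\lambda)^{-1},$$ where $(1+\lambda)^{-1}$ is the inverse in $\mathfrak G$. Under $\exp$ this is the gauge action of $\Gamma$: for $\lambda\in\mathrm F_1A_0$, $$\exp(\lambda)\cdot\alpha=\sum_{m\ge0}\frac{1}{m!}\,\mathrm{ad}_\lambda^m(\alpha)-\sum_{m\ge0}\frac{1}{(m+1)!}\,\mathrm{ad}_\lambda^m(\mathrm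 d\lambda),\qquad \mathrm{ad}_\lambda(x)=\lambda\star x-x\star\lambda .$$ -/

import Mathlib

open scoped Nat

/-- A left-unital complete differential graded pre-Lie algebra over `k`, with underlying
`ℤ`-graded vector space `A`. Homological grading: `d` lowers the degree by one. The degree of a
product or of a boundary is a separate index, tied to the other degrees by an equation. -/
structure CompleteDGPreLieAlgebra (k : Type*) [Field k] (A : ℤ → Type*)
    [∀ n, AddCommGroup (A n)] [∀ n, Module k (A n)] where
  /-- the differential `A_i → A_j`, `i = j + 1` -/
  d : ∀ {i j : ℤ}, j + 1 = i → A i →ₗ[k] A j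
  d_d : ∀ {i j l : ℤ} (hij : j + 1 = i) (hjl : l + 1 = j) (x : A i), d hjl (d hij x) = 0
  /-- the pre-Lie product `x ⋆ y` -/
  mul : ∀ {i j n : ℤ}, i + j = n → A i →ₗ[k] A j →ₗ[k] A n
  /-- the Leibniz rule `d (x ⋆ y) = dx ⋆ y + (-1)^|x| x ⋆ dy` -/
  d_mul : ∀ {i j n i' j' n' : ℤ} (h : i + j = n) (hi : i' + 1 = i) (hj : j' + 1 = j)
    (hn : n' + 1 = n) (h₁ : i' + j = n') (h₂ : i + j' = n') (x : A i) (y : A j),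
    d hn (mul h x y) = mul h₁ (d hi x) y + i.negOnePow • mul h₂ x (d hj y)
  /-- the associator is right symmetric:
  `(x ⋆ y) ⋆ z - x ⋆ (y ⋆ z) = (-1)^(|y||z|) ((x ⋆ z) ⋆ y - x ⋆ (z ⋆ y))` -/
  preLie : ∀ {a b c ab ac bc n : ℤ} (h₁ : a + b = ab) (h₂ : ab + c = n) (h₃ : b + c = bc)
    (h₄ : a + bc = n) (h₅ : a + c = ac) (h₆ : ac + b = n) (h₇ : c + b = bc)
    (x : A a) (y : A b) (z : A c),
    mul h₂ (mul h₁ x y) z - mul h₄ x (mul h₃ y z) =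
      (b * c).negOnePow • (mul h₆ (mul h₅ x z) y - mul h₄ x (mul h₇ z y))
  /-- the unit, a cycle of degree zero -/
  one : A 0
  d_one : ∀ {j : ℤ} (h : j + 1 = 0), d h one = 0
  one_mul : ∀ {n : ℤ} (h : 0 + n = n) (x : A n), mul h one x = x
  /-- the filtration `F_r A_n` -/
  fil : ℕ → ∀ n : ℤ, Submodule k (A n)
  fil_zero : ∀ n, fil 0 n = ⊤
  fil_succ_le : ∀ r n, fil (r + 1) n ≤ fil r n
  d_mem : ∀ {i j : ℤ} (h : j + 1 = i) {r : ℕ} {x : A i}, x ∈ fil r i → d h x ∈ fil r j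
  mul_mem : ∀ {i j n : ℤ} (h : i + j = n) {r s : ℕ} {x : A i} {y : A j},
    x ∈ fil r i → y ∈ fil s j → mul h x y ∈ fil (r + s) n
  /-- `A_n → lim_r A_n / F_r A_n` is injective -/
  separated : ∀ (n : ℤ) (x : A n), (∀ r, x ∈ fil r n) → x = 0
  /-- `A_n → lim_r A_n / F_r A_n` is surjective -/
  complete : ∀ (n : ℤ) (a : ℕ → A n), (∀ r, a (r + 1) - a r ∈ fil r n) →
    ∃ l, ∀ r, l - a r ∈ fil r n

namespace CompleteDGPreLieAlgebra

variable {k : Type*} [Field k] {A : ℤ → Type*} [∀ n, AddCommGroup (A n)] [∀ n, Module k (A n)]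
  (C : CompleteDGPreLieAlgebra k A)

/-! ### Limits and sums for the filtration -/

lemma fil_anti (n : ℤ) : Antitone fun r => C.fil r n :=
  antitone_nat_of_succ_le fun r => C.fil_succ_le r n

/-- `a` converges to `l` for the filtration. -/
def IsLim {n : ℤ} (a : ℕ → A n) (l : A n) : Prop :=
  ∀ r, ∃ N, ∀ m, N ≤ m → l - a m ∈ C.fil r n

lemma IsLim.unique {n : ℤ} {a : ℕ → A n} {l l' : A n} (h : C.IsLim a l) (h' : C.IsLim a l') :
    l = l' := by
  refine sub_eq_zero.1 (C.separated n _ fun r => ?_)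
  obtain ⟨N, hN⟩ := h r
  obtain ⟨N', hN'⟩ := h' r
  have := (C.fil r n).sub_mem (hN (max N N') (le_max_left _ _)) (hN' (max N N') (le_max_right _ _))
  simpa using this

lemma exists_isLim {n : ℤ} {a : ℕ → A n} (h : ∀ r, a (r + 1) - a r ∈ C.fil r n) :
    ∃ l, C.IsLim a l := by
  obtain ⟨l, hl⟩ := C.complete n a h
  exact ⟨l, fun r => ⟨r, fun m hm => C.fil_anti n hm (hl m)⟩⟩

open Classical in
/-- The limit of a convergent sequence (and `0` for a sequence that does not converge). -/
noncomputable def lim {n : ℤ} (a : ℕ → A n) : A n :=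
  if h : ∃ l, C.IsLim a l then h.choose else 0

lemma isLim_lim {n : ℤ} {a : ℕ → A n} (h : ∃ l, C.IsLim a l) : C.IsLim a (C.lim a) := by
  rw [lim, dif_pos h]
  exact h.choose_spec

/-- The series `∑ x_i` converges to `s` for the filtration. -/
def IsSum {n : ℤ} (x : ℕ → A n) (s : A n) : Prop :=
  C.IsLim (fun m => ∑ i ∈ Finset.range m, x i) s

/-- The sum of a convergent series. -/
noncomputable def sum {n : ℤ} (x : ℕ → A n) : A n :=
  C.lim fun m => ∑ i ∈ Finset.range m, x i

lemma isSum_sum {n : ℤ} {x : ℕ → A n} (h : ∀ i, x i ∈ C.fil i n) : C.IsSum x (C.sum x) :=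
  C.isLim_lim (C.exists_isLim fun r => by simpa [Finset.sum_range_succ] using h r)

/-- The filtration topology on `A_n`: the subsets `x + F_r A_n` form a basis of
neighbourhoods of `x`. -/
@[reducible]
def topology (n : ℤ) : TopologicalSpace (A n) where
  IsOpen U := ∀ x ∈ U, ∃ r, ∀ y, y - x ∈ C.fil r n → y ∈ U
  isOpen_univ := fun _ _ => ⟨0, fun _ _ => trivial⟩
  isOpen_inter := fun U V hU hV x hx => by
    obtain ⟨r, hr⟩ := hU x hx.1
    obtain ⟨s, hs⟩ := hV x hx.2
    exact ⟨max r s, fun y hy => ⟨hr y (C.fil_anti n (le_max_left r s) hy),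
      hs y (C.fil_anti n (le_max_right r s) hy)⟩⟩
  isOpen_sUnion := fun S hS x ⟨U, hU, hx⟩ => by
    obtain ⟨r, hr⟩ := hS U hU x hx
    exact ⟨r, fun y hy => ⟨U, hU, hr y hy⟩⟩

/-! ### Exponential, symmetric braces, circle product, Magnus expansion -/

/-- Right multiplication `x ↦ x ⋆ y` by an element of degree zero. -/
def rmul {n : ℤ} (x : A n) (y : A 0) : A n := C.mul (add_zero n) x y

lemma rmul_mem {n : ℤ} {r s : ℕ} {x : A n} {y : A 0} (hx : x ∈ C.fil r n) (hy : y ∈ C.fil s 0) :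
    C.rmul x y ∈ C.fil (r + s) n :=
  C.mul_mem _ hx hy

/-- The iterated right multiplication `((x ⋆ y) ⋆ y) ⋯ ⋆ y`, with `m` factors `y`. -/
def rmulIter {n : ℤ} (x : A n) (y : A 0) : ℕ → A n
  | 0 => x
  | m + 1 => C.rmul (rmulIter x y m) y

lemma rmulIter_mem {n : ℤ} {r : ℕ} {x : A n} {y : A 0} (hx : x ∈ C.fil r n)
    (hy : y ∈ C.fil 1 0) (m : ℕ) : C.rmulIter x y m ∈ C.fil (r + m) n := by
  induction m with
  | zero => exact hx
  | succ m ih => exact C.rmul_mem (r := r + m) (s := 1) ih hy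

/-- The pre-Lie exponential `exp(y) = 1 + y + y^{⋆2}/2! + y^{⋆3}/3! + ⋯`, where
`y^{⋆m} = ((y ⋆ y) ⋆ ⋯) ⋆ y`; as `1 ⋆ y = y`, this is the `m`-fold right multiplication
of `1` by `y`. -/
noncomputable def exp (y : A 0) : A 0 :=
  C.sum fun m => (m ! : k)⁻¹ • C.rmulIter C.one y m

/-- The symmetric braces `{x; y_1, …, y_m}` with `y_1, …, y_m` of degree zero. -/
def brace {n : ℤ} : (m : ℕ) → A n → (Fin m → A 0) → A n
  | 0, x, _ => x
  | m + 1, x, y =>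
    C.rmul (brace m x (Fin.init y)) (y (Fin.last m)) -
      ∑ i : Fin m, brace m x
        (Function.update (Fin.init y) i (C.rmul (Fin.init y i) (y (Fin.last m))))

lemma brace_mem_sum {n : ℤ} (m : ℕ) (x : A n) (e : Fin m → ℕ) (y : Fin m → A 0)
    (hy : ∀ i, y i ∈ C.fil (e i) 0) : C.brace m x y ∈ C.fil (∑ i, e i) n := by
  induction m with
  | zero => simp [C.fil_zero]
  | succ m ih =>
    rw [brace, Fin.sum_univ_castSucc]
    refine Submodule.sub_mem _ (C.rmul_mem (ih _ _ fun i => hy i.castSucc) (hy _))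
      (Submodule.sum_mem _ fun i _ => ?_)
    have h := ih (Function.update (fun j => e j.castSucc) i (e i.castSucc + e (Fin.last m)))
      (Function.update (Fin.init y) i (C.rmul (Fin.init y i) (y (Fin.last m)))) (fun j => by
        by_cases hj : j = i
        · subst hj
          simpa [Fin.init] using C.rmul_mem (hy j.castSucc) (hy (Fin.last m))
        · simpa [Function.update_of_ne hj, Fin.init] using hy j.castSucc)
    have hs : ∑ j, Function.update (fun j : Fin m => e j.castSucc) i
        (e i.castSucc + e (Fin.last m)) j = ∑ j : Fin m, e j.castSucc + e (Fin.last m) := by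
      rw [Finset.sum_update_of_mem (Finset.mem_univ i),
        Finset.sum_eq_add_sum_sdiff_singleton_of_mem (Finset.mem_univ i)]
      ring
    rwa [hs] at h

lemma brace_mem {n : ℤ} (m : ℕ) (x : A n) (y : Fin m → A 0) (hy : ∀ i, y i ∈ C.fil 1 0) :
    C.brace m x y ∈ C.fil m n := by
  simpa using C.brace_mem_sum m x (fun _ => 1) y hy

/-- The circle product `x ⊚ (1 + y) = ∑_m (1 / m!) {x; y, …, y}`, as a function of `x` and `y`. -/
noncomputable def circ {n : ℤ} (x : A n) (y : A 0) : A n :=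
  C.sum fun m => (m ! : k)⁻¹ • C.brace m x (fun _ => y)

lemma isSum_exp {y : A 0} (hy : y ∈ C.fil 1 0) :
    C.IsSum (fun m => (m ! : k)⁻¹ • C.rmulIter C.one y m) (C.exp y) :=
  C.isSum_sum fun m => Submodule.smul_mem _ _ (by
    simpa using C.rmulIter_mem (r := 0) (x := C.one) (by simp [C.fil_zero]) hy m)

lemma isSum_circ {n : ℤ} (x : A n) {y : A 0} (hy : y ∈ C.fil 1 0) :
    C.IsSum (fun m => (m ! : k)⁻¹ • C.brace m x (fun _ => y)) (C.circ x y) :=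
  C.isSum_sum fun m => Submodule.smul_mem _ _ (C.brace_mem m x _ fun _ => hy)

/-- Successive approximations of the solution `ω` of
`ω = ∑_m (B_m / m!) ((y ⋆ ω) ⋆ ω) ⋯ ⋆ ω` (with `m` factors `ω`), where the `B_m` are the
Bernoulli numbers with `B_1 = -1/2`. -/
noncomputable def magnusIter (y : A 0) : ℕ → A 0
  | 0 => 0
  | r + 1 => C.sum fun m =>
      ((bernoulli m / (m ! : ℚ) : ℚ) : k) • C.rmulIter y (magnusIter y r) m

/-- The Magnus expansion
`Ω(y) = y - (1/2) y ⋆ y + (1/4) y ⋆ (y ⋆ y) + (1/12) (y ⋆ y) ⋆ y + ⋯`, that is, the solution `ω`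
of `ω = ∑_m (B_m / m!) ((y ⋆ ω) ⋆ ω) ⋯ ⋆ ω`. -/
noncomputable def magnus (y : A 0) : A 0 := C.lim (C.magnusIter y)

/-! ### The Lie algebra of gauges and the Baker-Campbell-Hausdorff series -/

lemma preLie_zero (x y z : A 0) :
    C.rmul (C.rmul x y) z - C.rmul x (C.rmul y z) =
      C.rmul (C.rmul x z) y - C.rmul x (C.rmul z y) := by
  simpa [rmul] using C.preLie (add_zero 0) (add_zero 0) (add_zero 0) (add_zero 0) (add_zero 0)
    (add_zero 0) (add_zero 0) x y z

/-- The bracket `[x, y] = x ⋆ y - y ⋆ x` on `F_1 A_0`. -/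
instance : Bracket (C.fil 1 0) (C.fil 1 0) where
  bracket x y := ⟨C.rmul (x : A 0) (y : A 0) - C.rmul (y : A 0) (x : A 0),
    Submodule.sub_mem _ (C.fil_succ_le 1 0 (C.rmul_mem x.2 y.2))
      (C.fil_succ_le 1 0 (C.rmul_mem y.2 x.2))⟩

lemma coe_bracket (x y : C.fil 1 0) :
    ((⁅x, y⁆ : C.fil 1 0) : A 0) = C.rmul (x : A 0) (y : A 0) - C.rmul (y : A 0) (x : A 0) := rfl

instance : LieRing (C.fil 1 0) where
  add_lie x y z := Subtype.ext (by simp [coe_bracket, rmul]; abel)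
  lie_add x y z := Subtype.ext (by simp [coe_bracket, rmul]; abel)
  lie_self x := Subtype.ext (by simp [coe_bracket])
  leibniz_lie x y z := Subtype.ext (by
    have h1 := C.preLie_zero x y z
    have h2 := C.preLie_zero y x z
    have h3 := C.preLie_zero z x y
    simp only [coe_bracket, Submodule.coe_add]
    simp only [rmul, map_sub, LinearMap.sub_apply] at *
    rw [← sub_eq_zero] at h1 h2 h3 ⊢
    have h := congrArg₂ (· - ·) (congrArg₂ (· - ·) h2 h1) h3
    simp only [sub_zero] at h
    rw [← h]
    abel)

instance : LieAlgebra k (C.fil 1 0) where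
  lie_smul t x y := Subtype.ext (by simp [coe_bracket, rmul, smul_sub])

end CompleteDGPreLieAlgebra

/-! ### The Baker-Campbell-Hausdorff series -/

section BCH

variable (k : Type*) [Field k]

/-- The homogeneous component of degree `n` of `ln(exp(x) exp(y))` in the free complete unital
associative algebra on the two generators `x = ι 0` and `y = ι 1`: the coefficient of `t^n` in
`ln(exp(t x) exp(t y)) = ∑_{m ≥ 1} ((-1)^(m+1) / m) (exp(t x) exp(t y) - 1)^m`. -/
noncomputable def bchAssoc (n : ℕ) : FreeAlgebra k (Fin 2) :=
  let e : Fin 2 → PowerSeries (FreeAlgebra k (Fin 2)) := fun i =>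
    PowerSeries.mk fun j => (j ! : k)⁻¹ • FreeAlgebra.ι k i ^ j
  ∑ m ∈ Finset.Icc 1 n, ((-1) ^ (m + 1) / m : k) • PowerSeries.coeff n ((e 0 * e 1 - 1) ^ m)

attribute [local instance] LieRing.ofAssociativeRing in
/-- The canonical map from the free Lie algebra to the free associative algebra on two generators:
the morphism of Lie algebras that is the identity on generators. -/
noncomputable def lieToAssoc : FreeLieAlgebra k (Fin 2) →ₗ[k] FreeAlgebra k (Fin 2) :=
  (FreeLieAlgebra.lift k (FreeAlgebra.ι k) :
    FreeLieAlgebra k (Fin 2) →ₗ⁅k⁆ FreeAlgebra k (Fin 2))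

/-- The linear map from the free associative algebra to the free Lie algebra that sends a word
`x_1 x_2 ⋯ x_m` to the iterated bracket `[x_1, [x_2, [⋯, x_m]]]` (and the empty word to `0`).
It is given by the action of the free associative algebra on `k × Lie` for which a generator `x`
sends `(c, l)` to `(0, c x + [x, l])`, applied to the vector `(1, 0)`. -/
noncomputable def dynkinMap :
    FreeAlgebra k (Fin 2) →ₗ[k] FreeLieAlgebra k (Fin 2) :=
  let L := FreeLieAlgebra k (Fin 2)
  let ρ : FreeAlgebra k (Fin 2) →ₐ[k] Module.End k (k × L) := FreeAlgebra.lift k fun i =>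
    LinearMap.prod 0 (LinearMap.coprod (LinearMap.toSpanSingleton k L (FreeLieAlgebra.of k i))
      (LieAlgebra.ad k L (FreeLieAlgebra.of k i)))
  LinearMap.snd k k L ∘ₗ LinearMap.applyₗ ((1, 0) : k × L) ∘ₗ ρ.toLinearMap

/-- The homogeneous component of degree `n` of the Baker-Campbell-Hausdorff series
`ln(exp(x) exp(y))`, as an element of the free Lie algebra (Dynkin's form: each word
`x_1 ⋯ x_n` is replaced by `(1 / n) [x_1, [x_2, [⋯, x_n]]]`). -/
noncomputable def bchLie (n : ℕ) : FreeLieAlgebra k (Fin 2) :=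
  (n : k)⁻¹ • dynkinMap k (bchAssoc k n)

end BCH

namespace CompleteDGPreLieAlgebra

variable {k : Type*} [Field k] {A : ℤ → Type*} [∀ n, AddCommGroup (A n)] [∀ n, Module k (A n)]
  (C : CompleteDGPreLieAlgebra k A)

/-- The component of degree `n` of the Baker-Campbell-Hausdorff series at `x, y ∈ F_1 A_0`. -/
noncomputable def bchTerm (x y : C.fil 1 0) (n : ℕ) : A 0 :=
  (FreeLieAlgebra.lift k ![x, y] (bchLie k n) : C.fil 1 0)

/-- `BCH(x, y)`, the sum of the Baker-Campbell-Hausdorff series. -/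
noncomputable def bch (x y : C.fil 1 0) : A 0 := C.sum (C.bchTerm x y)

/-! ### Gauges, group-like elements, Maurer-Cartan elements -/

/-- The set `F_1 A_0` of gauges, underlying the gauge group. -/
def Gauge : Type _ := {x : A 0 // x ∈ C.fil 1 0}

/-- The set `1 + F_1 A_0` of group-like elements, underlying the deformation gauge group. -/
def GroupLike : Type _ := {g : A 0 // g - C.one ∈ C.fil 1 0}

/-- The set of Maurer-Cartan elements: `α` of degree `-1` with `dα + α ⋆ α = 0`. -/
def MaurerCartan : Type _ :=
  {α : A (-1) // C.d (j := -2) (by norm_num) α + C.mul (by norm_num) α α = 0}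

instance : TopologicalSpace C.Gauge := (C.topology 0).induced Subtype.val

instance : TopologicalSpace C.GroupLike := (C.topology 0).induced Subtype.val

instance : TopologicalSpace C.MaurerCartan := (C.topology (-1)).induced Subtype.val

/-! ### The two actions -/

/-- The adjoint action `ad_l(a) = [l, a] = l ⋆ a - a ⋆ l` of an element `l` of degree zero. -/
def ad {n : ℤ} (l : A 0) : A n →ₗ[k] A n :=
  C.mul (zero_add n) l - (C.mul (add_zero n)).flip l

/-- The gauge action `exp(ad_l)(α) + ((id - exp(ad_l)) / ad_l)(dl)`, where
`(id - exp(ad_l)) / ad_l = - ∑_m (1 / (m+1)!) ad_l^m`. -/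
noncomputable def gaugeAct (l : A 0) (α : A (-1)) : A (-1) :=
  C.sum (fun m => (m ! : k)⁻¹ • (C.ad l ^ m) α) -
    C.sum (fun m => ((m + 1)! : k)⁻¹ • (C.ad l ^ m) (C.d (by norm_num) l))

/-- The formula `((1 + l) ⋆ α) ⊚ (1 + l') - dl ⊚ (1 + l')`. -/
noncomputable def conjAct (l l' : A 0) (α : A (-1)) : A (-1) :=
  C.circ (C.mul (zero_add (-1)) (C.one + l) α) l' - C.circ (C.d (by norm_num) l) l'

end CompleteDGPreLieAlgebra

open Finset.HasAntidiagonal (antidiagonal mem_antidiagonal)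

/-! ### Evaluating power series at power series without constant term -/

/-! The proof turns everything into statements about right multiplications. Write `R_l` for `x ↦ x ⋆
l`. For `l` in `F_1 A_0` every power series `p(R_l)` converges (`rseries`), and `exp(l) =
e^{R_l}(1)`. Since `1 ⋆ l = l`, the equation `exp(l) = 1 + y` reads `((e^{R_l} - 1) / R_l)(l) = y`,
that is, `l = B(R_l)(y)` with `B` the Bernoulli series. This fixed-point problem is contracting for
the filtration, and its solution is the Magnus expansion; hence `exp` is bijective.

Two identities then give the group structure. The first, `circ_exp`, is `x ⊚ exp(l) = e^{R_l}(x)`: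
with `E(t) = exp(tl) - 1`, the symmetry of the braces and `E' = E ⋆ l + l` show that `x ⊚ exp(tl)`
solves `f' = f ⋆ l`. The second, `rseries_exp_bch`, is `e^{R_{BCH(x,y)}} = e^{R_y} e^{R_x}`. The
pre-Lie identity says that `l ↦ R_l` is a Lie morphism into the opposite of the endomorphism
algebra, so the identity follows from the associative one once `ln(e^x e^y)` is known to be a Lie
series. Together they say `exp(BCH(x,y)) = exp(x) ⊚ exp(y)`, and associativity of `⊚` becomes
associativity of composition.

That `ln(e^x e^y)` is the image of its Dynkin form (`lieToAssoc_bchLie`) comes from letting a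
generator `x` act on the dual numbers over the free algebra by `m ↦ (x + εx) m - m x`, a sum of two
commuting actions. The logarithm of a product of exponentials acts through this sum as the sum of
its two actions; on the vector `1`, the `ε`-part is `n` times the component of degree `n` on one
side and the iterated bracket on the other.

For the action, put `D_α(u) = (-1)^|u| u ⋆ α - du`. The commutator of `D_α` with `R_x` is `u ↦
(-1)^|u| u ⋆ (ad_x α - dx)`, and summing the iterated commutators gives `D_α e^{R_x} = e^{R_x}
D_{x·α}`, where `x·α` is the gauge action (`twist_rseries_exp`). Applied to `1`, where `D_α(1) = α`,
this yields the conjugation formula, and with `rseries_exp_bch` the action law. As `D_α² u = -u ⋆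
(dα + α ⋆ α)` in degree zero, Maurer–Cartan elements are preserved.

The topological claims hold because each map involved preserves congruence modulo every `F_r`. -/

lemma sum_range_sum_range_eq_sum_antidiagonal {M : Type*} [AddCommMonoid M] (N : ℕ)
    (f : ℕ → ℕ → M) (hf : ∀ i j, N ≤ i + j → f i j = 0) :
    ∑ i ∈ Finset.range N, ∑ j ∈ Finset.range N, f i j =
      ∑ m ∈ Finset.range N, ∑ p ∈ antidiagonal m, f p.1 p.2 := by
  rw [← Finset.sum_product', Finset.sum_sigma']
  symm
  refine Finset.sum_of_injOn (fun s => s.2) ?_ ?_ ?_ (fun _ _ => rfl)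
  · rintro ⟨m, a, b⟩ h ⟨m', a', b'⟩ h' e
    simp only [Finset.coe_sigma, Set.mem_sigma_iff, Finset.mem_coe, Finset.mem_range,
      mem_antidiagonal] at h h' e
    cases e
    obtain ⟨_, rfl⟩ := h
    obtain ⟨_, rfl⟩ := h'
    rfl
  · rintro ⟨m, a, b⟩ h
    simp only [Finset.coe_sigma, Set.mem_sigma_iff, Finset.mem_coe, Finset.mem_range,
      mem_antidiagonal, Finset.coe_product, Set.mem_prod] at h ⊢
    omega
  · rintro ⟨a, b⟩ h h'
    refine hf a b ?_
    by_contra! hlt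
    exact h' ⟨⟨a + b, a, b⟩, by simp [hlt], rfl⟩

namespace PowerSeries

section Eval

variable {k : Type*} [Field k] {B : Type*} [Ring B] [Algebra k B]
  {B' : Type*} [Ring B'] [Algebra k B']

lemma coeff_pow_eq_zero {u : PowerSeries B} (hu : constantCoeff u = 0) {n m : ℕ} (h : n < m) :
    coeff n (u ^ m) = 0 := by
  obtain ⟨v, rfl⟩ := X_dvd_iff.2 hu
  rw [((commute_X v).symm).mul_pow, coeff_X_pow_mul', if_neg (by omega)]

/-- The value at `u` of the power series `p`, meaningful when `u` has no constant term. -/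
noncomputable def evalSeries (u : PowerSeries B) (p : PowerSeries k) : PowerSeries B :=
  mk fun n => ∑ m ∈ Finset.range (n + 1), coeff m p • coeff n (u ^ m)

lemma coeff_evalSeries {u : PowerSeries B} (hu : constantCoeff u = 0) (p : PowerSeries k)
    {n N : ℕ} (h : n < N) :
    coeff n (evalSeries u p) = ∑ m ∈ Finset.range N, coeff m p • coeff n (u ^ m) := by
  rw [evalSeries, coeff_mk]
  refine Finset.sum_subset (Finset.range_subset_range.2 h) fun m _ hm => ?_
  rw [coeff_pow_eq_zero hu (by simpa using hm), smul_zero]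

lemma constantCoeff_evalSeries (u : PowerSeries B) (p : PowerSeries k)
    (hp : constantCoeff p = 0) : constantCoeff (evalSeries u p) = 0 := by
  rw [← coeff_zero_eq_constantCoeff_apply, evalSeries, coeff_mk]
  simp [hp]

@[simp]
lemma evalSeries_one (u : PowerSeries B) : evalSeries u (1 : PowerSeries k) = 1 := by
  ext n
  rw [evalSeries, coeff_mk, Finset.sum_eq_single 0] <;> simp +contextual [coeff_one]

lemma evalSeries_add (u : PowerSeries B) (p q : PowerSeries k) :
    evalSeries u (p + q) = evalSeries u p + evalSeries u q := by
  ext n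
  simp [evalSeries, add_smul, Finset.sum_add_distrib]

lemma evalSeries_mul {u : PowerSeries B} (hu : constantCoeff u = 0) (p q : PowerSeries k) :
    evalSeries u (p * q) = evalSeries u p * evalSeries u q := by
  ext n
  rw [coeff_mul]
  have h1 : ∀ x ∈ antidiagonal n,
      coeff x.1 (evalSeries u p) * coeff x.2 (evalSeries u q) =
        ∑ a ∈ Finset.range (n + 1), ∑ b ∈ Finset.range (n + 1),
          (coeff a p * coeff b q) • (coeff x.1 (u ^ a) * coeff x.2 (u ^ b)) := by
    intro x hx
    rw [mem_antidiagonal] at hx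
    rw [coeff_evalSeries hu p (N := n + 1) (by omega),
      coeff_evalSeries hu q (N := n + 1) (by omega), Finset.sum_mul_sum]
    simp only [smul_mul_smul_comm]
  rw [Finset.sum_congr rfl h1, Finset.sum_comm]
  simp_rw [Finset.sum_comm (s := antidiagonal n), ← Finset.smul_sum, ← coeff_mul, ← pow_add]
  rw [sum_range_sum_range_eq_sum_antidiagonal]
  · rw [evalSeries, coeff_mk]
    refine Finset.sum_congr rfl fun m _ => ?_
    rw [coeff_mul, Finset.sum_smul]
    refine Finset.sum_congr rfl fun x hx => ?_
    rw [mem_antidiagonal.1 hx]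
  · intro i j h
    rw [coeff_pow_eq_zero hu (by omega), smul_zero]

lemma evalSeries_pow {u : PowerSeries B} (hu : constantCoeff u = 0) (p : PowerSeries k) (m : ℕ) :
    evalSeries u (p ^ m) = evalSeries u p ^ m := by
  induction m with
  | zero => simp
  | succ m ih => rw [pow_succ, pow_succ, evalSeries_mul hu, ih]

lemma evalSeries_X {u : PowerSeries B} (hu : constantCoeff u = 0) :
    evalSeries u (X : PowerSeries k) = u := by
  ext n
  rw [coeff_evalSeries hu _ (show n < n + 2 by omega), Finset.sum_eq_single 1] <;>
    simp +contextual [coeff_X]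

/-- This reduces identities between exponential and logarithm in a noncommutative ring to identities
of scalar power series. -/
lemma evalSeries_subst {u : PowerSeries B} (hu : constantCoeff u = 0) (p : PowerSeries k)
    {q : PowerSeries k} (hq : constantCoeff q = 0) :
    evalSeries u (p.subst q) = evalSeries (evalSeries u q) p := by
  ext n
  have h1 : ∀ l < n + 1, coeff l (p.subst q) =
      ∑ m ∈ Finset.range (n + 1), coeff m p * coeff l (q ^ m) := by
    intro l hl
    rw [coeff_subst' (HasSubst.of_constantCoeff_zero' hq), finsum_eq_sum_of_support_subset (s := Finset.range (n + 1))]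
    · simp
    · intro m hm
      by_contra hm'
      refine hm ?_
      simp only [Finset.coe_range, Set.mem_Iio, not_lt] at hm'
      simp only [coeff_pow_eq_zero hq (show l < m by omega), smul_zero]
  rw [evalSeries, coeff_mk, evalSeries, coeff_mk]
  rw [Finset.sum_congr rfl fun l hl => by rw [h1 l (Finset.mem_range.1 hl)]]
  simp_rw [Finset.sum_smul]
  rw [Finset.sum_comm]
  refine Finset.sum_congr rfl fun m _ => ?_
  rw [← evalSeries_pow hu, evalSeries, coeff_mk, Finset.smul_sum]
  simp only [mul_smul]

lemma map_evalSeries (f : B →ₐ[k] B') (u : PowerSeries B) (p : PowerSeries k) :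
    map (f : B →+* B') (evalSeries u p) = evalSeries (map (f : B →+* B') u) p := by
  ext n
  simp [evalSeries, ← map_pow]

lemma monomial_one_pow (b : B) (m : ℕ) : monomial 1 b ^ m = monomial m (b ^ m) := by
  induction m with
  | zero => rw [pow_zero, pow_zero, monomial_zero_eq_C_apply, map_one]
  | succ m ih => rw [pow_succ, ih, monomial_mul_monomial, pow_succ]

lemma map_monomial (f : B →+* B') (n : ℕ) (b : B) :
    map f (monomial n b) = monomial n (f b) := by
  ext m
  rw [coeff_map, coeff_monomial, coeff_monomial]
  split_ifs <;> simp

lemma evalSeries_monomial (b : B) (p : PowerSeries k) :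
    evalSeries (monomial 1 b) p = mk fun n => coeff n p • b ^ n := by
  ext n
  rw [evalSeries, coeff_mk, coeff_mk, Finset.sum_eq_single n]
  · simp [monomial_one_pow]
  · intro m _ hm
    simp [monomial_one_pow, coeff_monomial, hm.symm]
  · simp

/-! ### Exponential and logarithm as inverse power series -/

variable [CharZero k]

lemma coeff_exp_eq (n : ℕ) : coeff n (exp k) = (n ! : k)⁻¹ := by simp

lemma evalSeries_exp_add {u v : PowerSeries B} (hu : constantCoeff u = 0)
    (hv : constantCoeff v = 0) (h : Commute u v) :
    evalSeries (u + v) (exp k) = evalSeries u (exp k) * evalSeries v (exp k) := by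
  ext n
  have h1 : ∀ x ∈ antidiagonal n,
      coeff x.1 (evalSeries u (exp k)) * coeff x.2 (evalSeries v (exp k)) =
        ∑ a ∈ Finset.range (n + 1), ∑ b ∈ Finset.range (n + 1),
          ((a ! : k)⁻¹ * (b ! : k)⁻¹) • (coeff x.1 (u ^ a) * coeff x.2 (v ^ b)) := by
    intro x hx
    rw [mem_antidiagonal] at hx
    rw [coeff_evalSeries hu _ (N := n + 1) (by omega),
      coeff_evalSeries hv _ (N := n + 1) (by omega), Finset.sum_mul_sum]
    simp only [smul_mul_smul_comm, coeff_exp_eq]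
  rw [coeff_mul, Finset.sum_congr rfl h1, Finset.sum_comm]
  simp_rw [Finset.sum_comm (s := antidiagonal n), ← Finset.smul_sum, ← coeff_mul]
  rw [sum_range_sum_range_eq_sum_antidiagonal]
  · rw [evalSeries, coeff_mk]
    refine Finset.sum_congr rfl fun m _ => ?_
    rw [h.add_pow', map_sum, Finset.smul_sum]
    refine Finset.sum_congr rfl fun x hx => ?_
    rw [map_nsmul, ← Nat.cast_smul_eq_nsmul k, smul_smul]
    congr 1
    -- The binomial coefficient divided by `(a + b)!` is `1 / (a! b!)`.
    rw [coeff_exp_eq, ← mem_antidiagonal.1 hx, Nat.cast_add_choose]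
    have := Nat.cast_ne_zero (R := k).2 (Nat.factorial_ne_zero (x.1 + x.2))
    field_simp
  · intro i j h
    rw [coeff_mul, Finset.sum_eq_zero, smul_zero]
    intro x hx
    rw [mem_antidiagonal] at hx
    by_cases h' : x.1 < i
    · rw [coeff_pow_eq_zero hu h', zero_mul]
    · rw [coeff_pow_eq_zero hv (n := x.2) (by omega), mul_zero]

variable (k) in
lemma derivative_log_mul : d⁄dX k (log k) * (1 + X) = 1 := by
  rw [deriv_log]
  ext n
  rcases n with _ | n
  · simp
  · rw [mul_add, mul_one, map_add, coeff_succ_mul_X]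
    simp [coeff_one, pow_succ]

variable (k) in
-- With `L = log'` and `E = exp ∘ log`, one has `E' = E L` and `L' = -L²`, so `E L` has zero
-- derivative and constant term `1`. Since `L (1 + X) = 1`, this forces `E = 1 + X`.
lemma exp_subst_log : (exp k).subst (log k) = 1 + X := by
  set L := d⁄dX k (log k) with hL
  set E := (exp k).subst (log k) with hE
  have hLX : L * (1 + X) = 1 := derivative_log_mul k
  have hE' : d⁄dX k E = E * L := by
    rw [hE, derivative_subst HasSubst.log, derivative_exp]
  have hL' : d⁄dX k L = - L ^ 2 := by
    have h := congrArg (d⁄dX k) hLX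
    simp only [Derivation.leibniz, map_add, Derivation.map_one_eq_zero, derivative_X, smul_eq_mul,
      zero_add, mul_one] at h
    linear_combination L * h - d⁄dX k L * hLX
  have h : E * L = 1 := by
    refine derivative.ext ?_ ?_
    · rw [Derivation.leibniz, hE', hL', Derivation.map_one_eq_zero, smul_eq_mul, smul_eq_mul]
      ring
    · have h1 : constantCoeff E = 1 := by
        rw [← coeff_zero_eq_constantCoeff_apply, hE, coeff_subst' HasSubst.log,
          finsum_eq_single _ 0]
        · simp
        · intro n hn
          simp [zero_pow hn]
      rw [map_mul, h1, hL, deriv_log]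
      simp [← coeff_zero_eq_constantCoeff_apply]
  linear_combination (1 + X) * h - E * hLX

variable (k) in
lemma log_subst_exp_sub_one : (log k).subst (exp k - 1) = X := by
  refine derivative.ext ?_ ?_
  · rw [derivative_subst HasSubst.exp_sub_one, map_sub, derivative_exp,
      Derivation.map_one_eq_zero, sub_zero, derivative_X]
    have h := congrArg (fun f => f.subst (exp k - 1)) (derivative_log_mul k)
    have h1 : (1 : PowerSeries k).subst (exp k - 1) = 1 := by
      rw [← coe_substAlgHom HasSubst.exp_sub_one, map_one]
    simpa [subst_mul HasSubst.exp_sub_one, subst_add HasSubst.exp_sub_one, h1,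
      subst_X HasSubst.exp_sub_one] using h
  · rw [← coeff_zero_eq_constantCoeff_apply, coeff_subst' HasSubst.exp_sub_one, finsum_eq_single _ 0]
    · simp
    · intro n hn
      simp [zero_pow hn]

lemma evalSeries_exp_log {u : PowerSeries B} (hu : constantCoeff u = 0) :
    evalSeries (evalSeries u (log k)) (exp k) = 1 + u := by
  rw [← evalSeries_subst hu _ constantCoeff_log, exp_subst_log, evalSeries_add, evalSeries_one,
    evalSeries_X hu]

lemma evalSeries_log_exp {u : PowerSeries B} (hu : constantCoeff u = 0) :
    evalSeries (evalSeries u (exp k) - 1) (log k) = u := by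
  have h : evalSeries u (exp k) - 1 = evalSeries u (exp k - 1) := by
    rw [sub_eq_iff_eq_add, ← evalSeries_one (k := k) u, ← evalSeries_add, sub_add_cancel]
  rw [h, ← evalSeries_subst hu _ (by simp), log_subst_exp_sub_one, evalSeries_X hu]

end Eval

end PowerSeries

/-! ### The Baker-Campbell-Hausdorff series is a Lie series -/

section BCHSeries

open PowerSeries

variable (k : Type*) [Field k]

lemma constantCoeff_monomial_one {B : Type*} [Ring B] (b : B) :
    constantCoeff (monomial 1 b) = 0 := by
  rw [← coeff_zero_eq_constantCoeff_apply, coeff_monomial, if_neg (by norm_num)]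

/-- The morphism to the dual numbers over the free algebra that sends each generator `x` to
`x + ε x`, so that the coefficient of `ε` is the degree derivation. -/
noncomputable def degreeHom : FreeAlgebra k (Fin 2) →ₐ[k] DualNumber (FreeAlgebra k (Fin 2)) :=
  FreeAlgebra.lift k fun i =>
    TrivSqZeroExt.inl (FreeAlgebra.ι k i) + TrivSqZeroExt.inr (FreeAlgebra.ι k i)

lemma degreeHom_ι (i : Fin 2) : degreeHom k (FreeAlgebra.ι k i) =
    TrivSqZeroExt.inl (FreeAlgebra.ι k i) + TrivSqZeroExt.inr (FreeAlgebra.ι k i) := by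
  rw [degreeHom, FreeAlgebra.lift_ι_apply]

/-- Left multiplication through `degreeHom` on the dual numbers. -/
noncomputable def degreeLeft :
    FreeAlgebra k (Fin 2) →ₐ[k] Module.End k (DualNumber (FreeAlgebra k (Fin 2))) :=
  (Algebra.lmul k _).comp (degreeHom k)

/-- The action on the dual numbers for which a generator `x` sends `m` to `-m x`. -/
noncomputable def negRight :
    FreeAlgebra k (Fin 2) →ₐ[k] Module.End k (DualNumber (FreeAlgebra k (Fin 2))) :=
  FreeAlgebra.lift k fun i => -LinearMap.mulRight k (TrivSqZeroExt.inl (FreeAlgebra.ι k i))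

/-- The action on the dual numbers for which a generator `x` sends `m` to
`(x + ε x) m - m x`. -/
noncomputable def degreeAd :
    FreeAlgebra k (Fin 2) →ₐ[k] Module.End k (DualNumber (FreeAlgebra k (Fin 2))) :=
  FreeAlgebra.lift k fun i =>
    degreeLeft k (FreeAlgebra.ι k i) + negRight k (FreeAlgebra.ι k i)

lemma negRight_ι_apply (i : Fin 2) (m : DualNumber (FreeAlgebra k (Fin 2))) :
    negRight k (FreeAlgebra.ι k i) m = -(m * TrivSqZeroExt.inl (FreeAlgebra.ι k i)) := by
  rw [negRight, FreeAlgebra.lift_ι_apply]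
  rfl

lemma degreeLeft_apply (u : FreeAlgebra k (Fin 2)) (m : DualNumber (FreeAlgebra k (Fin 2))) :
    degreeLeft k u m = degreeHom k u * m := rfl

/-- Right multiplication by generators without `ε` creates no `ε`, so this action contributes
nothing to the `ε`-part when applied to `1`. -/
lemma snd_negRight_inl (u a : FreeAlgebra k (Fin 2)) :
    (negRight k u (TrivSqZeroExt.inl a)).snd = 0 := by
  induction u using FreeAlgebra.induction generalizing a with
  | grade0 r => simp [Algebra.algebraMap_eq_smul_one]
  | grade1 i => simp [negRight_ι_apply]
  | mul u v hu hv =>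
    have h : negRight k v (TrivSqZeroExt.inl a) =
        TrivSqZeroExt.inl (negRight k v (TrivSqZeroExt.inl a)).fst := by
      ext
      · simp
      · simpa using hv a
    rw [map_mul, Module.End.mul_apply, h, hu]
  | add u v hu hv => simp [hu, hv]

lemma commute_degreeLeft_negRight (u v : FreeAlgebra k (Fin 2)) :
    Commute (degreeLeft k u) (negRight k v) := by
  induction v using FreeAlgebra.induction with
  | grade0 r =>
    rw [AlgHom.commutes]
    exact Algebra.commutes' _ _ |>.symm
  | grade1 i =>
    ext1 m
    simp only [Module.End.mul_apply, negRight_ι_apply, degreeLeft_apply, mul_neg, mul_assoc]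
  | mul v w hv hw =>
    rw [map_mul]
    exact hv.mul_right hw
  | add v w hv hw =>
    rw [map_add]
    exact hv.add_right hw

lemma PowerSeries.commute_map_map {B B' : Type*} [Ring B] [Ring B'] (f g : B →+* B')
    (h : ∀ a b, Commute (f a) (g b)) (u v : PowerSeries B) :
    Commute (PowerSeries.map f u) (PowerSeries.map g v) := by
  ext n
  rw [coeff_mul, coeff_mul, ← Finset.Nat.sum_antidiagonal_swap]
  refine Finset.sum_congr rfl fun p _ => ?_
  simp only [coeff_map, Prod.fst_swap, Prod.snd_swap]
  exact h _ _

/-- The action of the free associative algebra on `k × Lie` that defines the Dynkin map. -/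
noncomputable def dynkinRep :
    FreeAlgebra k (Fin 2) →ₐ[k] Module.End k (k × FreeLieAlgebra k (Fin 2)) :=
  FreeAlgebra.lift k fun i =>
    LinearMap.prod 0 (LinearMap.coprod
      (LinearMap.toSpanSingleton k (FreeLieAlgebra k (Fin 2)) (FreeLieAlgebra.of k i))
      (LieAlgebra.ad k (FreeLieAlgebra k (Fin 2)) (FreeLieAlgebra.of k i)))

lemma dynkinMap_apply (u : FreeAlgebra k (Fin 2)) :
    dynkinMap k u = (dynkinRep k u (1, 0)).2 := rfl

lemma dynkinRep_ι_apply (i : Fin 2) (v : k × FreeLieAlgebra k (Fin 2)) :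
    dynkinRep k (FreeAlgebra.ι k i) v =
      (0, v.1 • FreeLieAlgebra.of k i + ⁅FreeLieAlgebra.of k i, v.2⁆) := by
  rw [dynkinRep, FreeAlgebra.lift_ι_apply]
  simp [LinearMap.toSpanSingleton_apply]

section

attribute [local instance] LieRing.ofAssociativeRing

lemma lieToAssoc_lie_of (i : Fin 2) (l : FreeLieAlgebra k (Fin 2)) :
    lieToAssoc k ⁅FreeLieAlgebra.of k i, l⁆ =
      FreeAlgebra.ι k i * lieToAssoc k l - lieToAssoc k l * FreeAlgebra.ι k i := by
  simp [lieToAssoc, LieHom.map_lie, FreeLieAlgebra.lift_of_apply, Ring.lie_def]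

lemma lieToAssoc_of (i : Fin 2) :
    lieToAssoc k (FreeLieAlgebra.of k i) = FreeAlgebra.ι k i := by
  simp [lieToAssoc, FreeLieAlgebra.lift_of_apply]

end

/-- `(c, l) ↦ c + ε l`, which intertwines `dynkinRep` and `degreeAd`. -/
noncomputable def toDual :
    k × FreeLieAlgebra k (Fin 2) →ₗ[k] DualNumber (FreeAlgebra k (Fin 2)) :=
  LinearMap.coprod (LinearMap.toSpanSingleton k _ 1)
    ((TrivSqZeroExt.inrHom (FreeAlgebra k (Fin 2)) (FreeAlgebra k (Fin 2))).restrictScalars k ∘ₗ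
      lieToAssoc k)

lemma toDual_apply (v : k × FreeLieAlgebra k (Fin 2)) :
    toDual k v = v.1 • 1 + TrivSqZeroExt.inr (lieToAssoc k v.2) := by
  simp [toDual, LinearMap.toSpanSingleton_apply]

/-- On a generator, `(x + εx)(c + εl) - (c + εl)x = ε(c x + [x, l])`: the terms without `ε` cancel.
Hence the `ε`-part of `degreeAd u` at `1` is the Dynkin map of `u`. -/
lemma toDual_dynkinRep (u : FreeAlgebra k (Fin 2)) (v : k × FreeLieAlgebra k (Fin 2)) :
    toDual k (dynkinRep k u v) = degreeAd k u (toDual k v) := by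
  induction u using FreeAlgebra.induction generalizing v with
  | grade0 r => simp [Algebra.algebraMap_eq_smul_one]
  | grade1 i =>
    rw [degreeAd, FreeAlgebra.lift_ι_apply, LinearMap.add_apply, negRight_ι_apply,
      degreeLeft_apply, degreeHom_ι, dynkinRep_ι_apply, toDual_apply, toDual_apply]
    simp only [map_add, map_smul, lieToAssoc_lie_of, lieToAssoc_of]
    ext
    · simp
    · simp
      abel
  | mul u w hu hw => rw [map_mul, map_mul, Module.End.mul_apply, Module.End.mul_apply, hu, hw]
  | add u w hu hw => rw [map_add, map_add, LinearMap.add_apply, map_add, hu, hw]; rfl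

variable [CharZero k]

/-- The exponential `exp(t x_i)` in the power series ring over the free algebra. -/
noncomputable def expGen (i : Fin 2) : PowerSeries (FreeAlgebra k (Fin 2)) :=
  evalSeries (monomial 1 (FreeAlgebra.ι k i)) (exp k)

/-- The generating series of the homogeneous components of `ln(exp(x) exp(y))`. -/
noncomputable def bchSeries : PowerSeries (FreeAlgebra k (Fin 2)) := mk (bchAssoc k)

lemma expGen_eq (i : Fin 2) :
    expGen k i = mk fun j => (j ! : k)⁻¹ • FreeAlgebra.ι k i ^ j := by
  rw [expGen, evalSeries_monomial]
  simp only [coeff_exp_eq]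

lemma constantCoeff_expGen (i : Fin 2) : constantCoeff (expGen k i) = 1 := by
  rw [← coeff_zero_eq_constantCoeff_apply, expGen_eq, coeff_mk]
  simp

lemma constantCoeff_expGen_mul_sub_one : constantCoeff (expGen k 0 * expGen k 1 - 1) = 0 := by
  simp [constantCoeff_expGen]

lemma bchSeries_eq : bchSeries k = evalSeries (expGen k 0 * expGen k 1 - 1) (log k) := by
  ext n
  rw [bchSeries, coeff_mk, bchAssoc, evalSeries, coeff_mk, Finset.sum_range_eq_add_Ico _ (by omega)]
  simp only [← expGen_eq]
  -- The term `m = 0` drops out, since the logarithm has no constant term; this matches the sum over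
  -- `Icc 1 n`.
  rw [coeff_log, if_pos rfl, zero_smul, zero_add]
  refine Finset.sum_congr (by ext; simp) fun m hm => ?_
  rw [Finset.mem_Ico] at hm
  rw [coeff_log, if_neg (by omega)]
  simp

lemma constantCoeff_bchSeries : constantCoeff (bchSeries k) = 0 := by
  rw [bchSeries_eq]
  exact constantCoeff_evalSeries _ _ constantCoeff_log

lemma evalSeries_bchSeries_exp : evalSeries (bchSeries k) (exp k) = expGen k 0 * expGen k 1 := by
  rw [bchSeries_eq, evalSeries_exp_log (constantCoeff_expGen_mul_sub_one k), add_sub_cancel]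

/-- The form in which homogeneity is used. It serves once with the eigenspaces of the degree
derivation and once with the operators that raise a filtration by `n`. -/
lemma bchAssoc_mem {W : ℕ → Submodule k (FreeAlgebra k (Fin 2))} (h_one : 1 ∈ W 0)
    (h_mul : ∀ i j a b, a ∈ W i → b ∈ W j → a * b ∈ W (i + j))
    (h_gen : ∀ i, FreeAlgebra.ι k i ∈ W 1) (n : ℕ) : bchAssoc k n ∈ W n := by
  have h_mul' : ∀ f g : PowerSeries (FreeAlgebra k (Fin 2)), (∀ n, coeff n f ∈ W n) →
      (∀ n, coeff n g ∈ W n) → ∀ n, coeff n (f * g) ∈ W n := by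
    intro f g hf hg n
    rw [coeff_mul]
    refine Submodule.sum_mem _ fun p hp => ?_
    rw [← mem_antidiagonal.1 hp]
    exact h_mul _ _ _ _ (hf _) (hg _)
  have h_one' : ∀ n, coeff n (1 : PowerSeries (FreeAlgebra k (Fin 2))) ∈ W n := by
    intro n
    rw [coeff_one]
    split_ifs with h
    · exact h ▸ h_one
    · exact Submodule.zero_mem _
  have h_exp : ∀ i n, coeff n (expGen k i) ∈ W n := by
    intro i n
    rw [expGen_eq, coeff_mk]
    refine Submodule.smul_mem _ _ ?_
    induction n with
    | zero => simpa using h_one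
    | succ n ih => exact h_mul _ _ _ _ ih (h_gen i)
  have h_pow : ∀ m n, coeff n ((expGen k 0 * expGen k 1 - 1) ^ m) ∈ W n := by
    intro m
    induction m with
    | zero => simpa using h_one'
    | succ m ih =>
      refine h_mul' _ _ ih fun n => ?_
      rw [map_sub]
      exact Submodule.sub_mem _ (h_mul' _ _ (h_exp 0) (h_exp 1) n) (h_one' n)
  have h := congrArg (coeff n) (bchSeries_eq k)
  rw [bchSeries, coeff_mk] at h
  rw [h, evalSeries, coeff_mk]
  exact Submodule.sum_mem _ fun m _ => Submodule.smul_mem _ _ (h_pow m n)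

lemma degreeHom_bchAssoc (n : ℕ) : degreeHom k (bchAssoc k n) =
    TrivSqZeroExt.inl (bchAssoc k n) + TrivSqZeroExt.inr ((n : k) • bchAssoc k n) := by
  let W : ℕ → Submodule k (FreeAlgebra k (Fin 2)) := fun n =>
    { carrier := {u | degreeHom k u = TrivSqZeroExt.inl u + TrivSqZeroExt.inr ((n : k) • u)}
      add_mem' := fun {a b} ha hb => by
        rw [Set.mem_ofPred_eq] at *
        rw [map_add, ha, hb, smul_add, TrivSqZeroExt.inl_add, TrivSqZeroExt.inr_add]
        abel
      zero_mem' := by simp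
      smul_mem' := fun c a ha => by
        rw [Set.mem_ofPred_eq] at *
        rw [map_smul, ha, smul_add, TrivSqZeroExt.inl_smul, smul_comm _ c, TrivSqZeroExt.inr_smul _ c] }
  refine bchAssoc_mem k (W := W) ?_ ?_ ?_ n
  · change degreeHom k 1 = _
    simp
  · intro i j a b ha hb
    change degreeHom k a = _ at ha
    change degreeHom k b = _ at hb
    change degreeHom k (a * b) = _
    rw [map_mul, ha, hb]
    ext
    · simp
    · simp [add_smul]
      abel
  · intro i
    change degreeHom k _ = _
    rw [degreeHom_ι]
    simp

lemma map_degreeAd_expGen (i : Fin 2) :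
    PowerSeries.map (RingHomClass.toRingHom (degreeAd k)) (expGen k i) =
      PowerSeries.map (RingHomClass.toRingHom (degreeLeft k)) (expGen k i) *
        PowerSeries.map (RingHomClass.toRingHom (negRight k)) (expGen k i) := by
  simp only [expGen, map_evalSeries, PowerSeries.map_monomial, RingHom.coe_coe]
  rw [← evalSeries_exp_add (constantCoeff_monomial_one _) (constantCoeff_monomial_one _), ← map_add]
  · congr 2
    rw [degreeAd, FreeAlgebra.lift_ι_apply]
  · rw [Commute, SemiconjBy, monomial_mul_monomial, monomial_mul_monomial,
      (commute_degreeLeft_negRight k _ _).eq]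

/-- The analogue of primitivity. Both actions commute, so the image of `e^x e^y` under `degreeAd`
regroups as the product of its images under `degreeLeft` and `negRight`, which is the exponential of
the sum of the two logarithms. -/
lemma degreeAd_bchAssoc (n : ℕ) : degreeAd k (bchAssoc k n) =
    degreeLeft k (bchAssoc k n) + negRight k (bchAssoc k n) := by
  have hfg := PowerSeries.commute_map_map (RingHomClass.toRingHom (degreeLeft k))
    (RingHomClass.toRingHom (negRight k)) (commute_degreeLeft_negRight k)
  have h0 : ∀ F : FreeAlgebra k (Fin 2) →ₐ[k]
      Module.End k (DualNumber (FreeAlgebra k (Fin 2))),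
      constantCoeff (PowerSeries.map (RingHomClass.toRingHom F) (bchSeries k)) = 0 := by
    intro F
    rw [← coeff_zero_eq_constantCoeff_apply, coeff_map, coeff_zero_eq_constantCoeff_apply,
      constantCoeff_bchSeries, map_zero]
  have h1 : evalSeries (PowerSeries.map (RingHomClass.toRingHom (degreeAd k)) (bchSeries k))
      (exp k) = evalSeries (PowerSeries.map (RingHomClass.toRingHom (degreeLeft k)) (bchSeries k) +
        PowerSeries.map (RingHomClass.toRingHom (negRight k)) (bchSeries k)) (exp k) := by
    rw [evalSeries_exp_add (h0 _) (h0 _) (hfg _ _), ← map_evalSeries, ← map_evalSeries,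
      ← map_evalSeries, evalSeries_bchSeries_exp, map_mul, map_mul, map_mul, map_degreeAd_expGen,
      map_degreeAd_expGen, mul_assoc, mul_assoc,
      ← mul_assoc (PowerSeries.map (RingHomClass.toRingHom (negRight k)) _),
      ← (hfg (expGen k 1) (expGen k 0)).eq, mul_assoc]
  -- The exponential is injective on series without constant term, by applying the logarithm.
  have h2 := congrArg (fun s => coeff n (evalSeries (s - 1) (log k))) h1
  rw [evalSeries_log_exp (h0 _), evalSeries_log_exp (by rw [map_add, h0, h0, add_zero])] at h2
  simpa [bchSeries] using h2

theorem lieToAssoc_bchLie (n : ℕ) : lieToAssoc k (bchLie k n) = bchAssoc k n := by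
  rcases Nat.eq_zero_or_pos n with rfl | hn
  · simp [bchLie, bchAssoc]
  -- The `ε`-part at `1` is the Dynkin bracket on the left and `n` times the component on the right.
  have h := congrArg TrivSqZeroExt.snd (toDual_dynkinRep k (bchAssoc k n) (1, 0))
  rw [degreeAd_bchAssoc, LinearMap.add_apply, degreeLeft_apply, degreeHom_bchAssoc] at h
  have h1 : toDual k (1, 0) = TrivSqZeroExt.inl 1 := by simp [toDual_apply]
  rw [h1, TrivSqZeroExt.snd_add, snd_negRight_inl, toDual_apply, ← dynkinMap_apply] at h
  simp only [TrivSqZeroExt.snd_add, TrivSqZeroExt.snd_smul, TrivSqZeroExt.snd_one, smul_zero,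
    zero_add, TrivSqZeroExt.snd_inr, TrivSqZeroExt.inl_one, mul_one, TrivSqZeroExt.snd_inl,
    add_zero] at h
  rw [bchLie, map_smul, h, smul_smul, inv_mul_cancel₀ (by exact_mod_cast hn.ne'), one_smul]

end BCHSeries

/-! ### Convergent series for the filtration -/

namespace CompleteDGPreLieAlgebra

variable {k : Type*} [Field k] {A : ℤ → Type*} [∀ n, AddCommGroup (A n)] [∀ n, Module k (A n)]
  (C : CompleteDGPreLieAlgebra k A)

section Limits

variable {C} {n : ℤ}

lemma isLim_iff_eventually {a : ℕ → A n} {l : A n} :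
    C.IsLim a l ↔ ∀ r, ∀ᶠ m in Filter.atTop, l - a m ∈ C.fil r n := by
  simp only [IsLim, Filter.eventually_atTop]

lemma IsLim.sub_mem {a a' : ℕ → A n} {l l' : A n} (h : C.IsLim a l) (h' : C.IsLim a' l') {r : ℕ}
    (H : ∀ᶠ m in Filter.atTop, a m - a' m ∈ C.fil r n) : l - l' ∈ C.fil r n := by
  rw [isLim_iff_eventually] at h h'
  obtain ⟨m, h1, h2, h3⟩ := ((h r).and ((h' r).and H)).exists
  have := (C.fil r n).sub_mem ((C.fil r n).add_mem h1 h3) h2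
  convert this using 1
  abel

lemma isLim_const (l : A n) : C.IsLim (fun _ => l) l := fun r => ⟨0, fun _ _ => by simp⟩

lemma IsLim.mem {a : ℕ → A n} {l : A n} (h : C.IsLim a l) {r : ℕ}
    (H : ∀ᶠ m in Filter.atTop, a m ∈ C.fil r n) : l ∈ C.fil r n := by
  simpa using h.sub_mem (isLim_const 0) (r := r) (by simpa using H)

lemma IsLim.add {a a' : ℕ → A n} {l l' : A n} (h : C.IsLim a l) (h' : C.IsLim a' l') :
    C.IsLim (fun m => a m + a' m) (l + l') := by
  rw [isLim_iff_eventually] at *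
  intro r
  filter_upwards [h r, h' r] with m h1 h2
  rw [add_sub_add_comm]
  exact Submodule.add_mem _ h1 h2

lemma IsLim.map {n' : ℤ} {a : ℕ → A n} {l : A n} (h : C.IsLim a l) (L : A n →ₗ[k] A n')
    (hL : ∀ r x, x ∈ C.fil r n → L x ∈ C.fil r n') : C.IsLim (fun m => L (a m)) (L l) := by
  rw [isLim_iff_eventually] at *
  intro r
  filter_upwards [h r] with m h1
  rw [← map_sub]
  exact hL r _ h1

lemma IsSum.unique {x : ℕ → A n} {s s' : A n} (h : C.IsSum x s) (h' : C.IsSum x s') : s = s' :=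
  IsLim.unique C h h'

lemma IsSum.add {x x' : ℕ → A n} {s s' : A n} (h : C.IsSum x s) (h' : C.IsSum x' s') :
    C.IsSum (fun m => x m + x' m) (s + s') := by
  simpa [IsSum, Finset.sum_add_distrib] using IsLim.add h h'

lemma IsSum.map {n' : ℤ} {x : ℕ → A n} {s : A n} (h : C.IsSum x s) (L : A n →ₗ[k] A n')
    (hL : ∀ r x, x ∈ C.fil r n → L x ∈ C.fil r n') : C.IsSum (fun m => L (x m)) (L s) := by
  simpa [IsSum] using IsLim.map h L hL

lemma IsSum.neg {x : ℕ → A n} {s : A n} (h : C.IsSum x s) : C.IsSum (fun m => -x m) (-s) :=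
  h.map (-LinearMap.id) fun r _ => (C.fil r n).neg_mem

lemma IsSum.sub {x x' : ℕ → A n} {s s' : A n} (h : C.IsSum x s) (h' : C.IsSum x' s') :
    C.IsSum (fun m => x m - x' m) (s - s') := by
  simpa [sub_eq_add_neg] using h.add h'.neg

lemma IsSum.sub_mem {x x' : ℕ → A n} {s s' : A n} (h : C.IsSum x s) (h' : C.IsSum x' s') {r : ℕ}
    (H : ∀ m, x m - x' m ∈ C.fil r n) : s - s' ∈ C.fil r n :=
  IsLim.sub_mem h h' (Filter.Eventually.of_forall fun m => by
    rw [← Finset.sum_sub_distrib]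
    exact Submodule.sum_mem _ fun i _ => H i)

lemma IsSum.mem {x : ℕ → A n} {s : A n} (h : C.IsSum x s) {r : ℕ}
    (H : ∀ m, x m ∈ C.fil r n) : s ∈ C.fil r n :=
  IsLim.mem h (Filter.Eventually.of_forall fun _ => Submodule.sum_mem _ fun i _ => H i)

lemma isSum_single {x : ℕ → A n} (i : ℕ) (h : ∀ j, j ≠ i → x j = 0) : C.IsSum x (x i) := by
  refine fun r => ⟨i + 1, fun m hm => ?_⟩
  beta_reduce
  rw [Finset.sum_eq_single i (fun j _ hj => h j hj) (fun hi => by simp at hi; omega), sub_self]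
  exact Submodule.zero_mem _

lemma IsSum.smodEq {x : ℕ → A n} {s : A n} (h : C.IsSum x s) (hx : ∀ i, x i ∈ C.fil i n) (N : ℕ) :
    s ≡ ∑ i ∈ Finset.range N, x i [SMOD C.fil N n] := by
  rw [SModEq.sub_mem]
  refine IsLim.sub_mem h (isLim_const _) ?_
  filter_upwards [Filter.eventually_ge_atTop N] with m hm
  rw [Finset.sum_range_sub_sum_range hm]
  refine Submodule.sum_mem _ fun i hi => ?_
  exact C.fil_anti n (Finset.mem_filter.1 hi).2 (hx i)

lemma isSum_of_smodEq {x : ℕ → A n} {s : A n}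
    (h : ∀ N, s ≡ ∑ i ∈ Finset.range N, x i [SMOD C.fil N n]) : C.IsSum x s :=
  fun r => ⟨r, fun m hm => C.fil_anti n hm (SModEq.sub_mem.1 (h m))⟩

lemma eq_of_smodEq {x y : A n} (h : ∀ r, x ≡ y [SMOD C.fil r n]) : x = y :=
  sub_eq_zero.1 (C.separated n _ fun r => SModEq.sub_mem.1 (h r))

lemma sum_range_sum_range_smodEq {b : ℕ → ℕ → A n} (hb : ∀ i j, b i j ∈ C.fil (i + j) n) (N : ℕ) :
    ∑ i ∈ Finset.range N, ∑ j ∈ Finset.range N, b i j ≡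
      ∑ m ∈ Finset.range N, ∑ p ∈ antidiagonal m, b p.1 p.2 [SMOD C.fil N n] := by
  have h := sum_range_sum_range_eq_sum_antidiagonal N
    (fun i j => if i + j < N then b i j else 0) (fun i j h => if_neg (by omega))
  have h' : ∑ m ∈ Finset.range N, ∑ p ∈ antidiagonal m, b p.1 p.2 =
      ∑ m ∈ Finset.range N, ∑ p ∈ antidiagonal m, if p.1 + p.2 < N then b p.1 p.2 else 0 := by
    refine Finset.sum_congr rfl fun m hm => Finset.sum_congr rfl fun p hp => ?_
    rw [mem_antidiagonal] at hp
    rw [if_pos (by rw [hp]; simpa using hm)]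
  rw [h', ← h]
  refine SModEq.sum fun i _ => SModEq.sum fun j _ => ?_
  split_ifs with hij
  · rfl
  · exact SModEq.zero.2 (C.fil_anti n (by omega) (hb i j))

/-- Modulo `F_N` only the finitely many terms with `i + j < N` matter, so the double series may be
summed along diagonals. -/
lemma IsSum.antidiagonal {b : ℕ → ℕ → A n} (hb : ∀ i j, b i j ∈ C.fil (i + j) n) {s : ℕ → A n}
    (hs : ∀ j, C.IsSum (fun i => b i j) (s j)) {S : A n} (hS : C.IsSum s S) :
    C.IsSum (fun m => ∑ p ∈ antidiagonal m, b p.1 p.2) S := by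
  refine isSum_of_smodEq fun N => ?_
  have hsj : ∀ j, s j ∈ C.fil j n := fun j =>
    (hs j).mem fun i => C.fil_anti n (Nat.le_add_left j i) (hb i j)
  refine ((hS.smodEq hsj N).trans ?_).trans (sum_range_sum_range_smodEq hb N)
  rw [Finset.sum_comm]
  exact SModEq.sum fun j _ =>
    (hs j).smodEq (fun i => C.fil_anti n (Nat.le_add_right i j) (hb i j)) N

end Limits

/-! ### Power series in a right multiplication -/

/-- The right multiplication `x ↦ x ⋆ l` as a linear map. -/
def rmulLin (n : ℤ) (l : A 0) : Module.End k (A n) := (C.mul (add_zero n)).flip l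

variable {n : ℤ}

lemma rmulLin_apply (l : A 0) (x : A n) : C.rmulLin n l x = C.rmul x l := rfl

lemma rmulIter_eq (x : A n) (l : A 0) (m : ℕ) : C.rmulIter x l m = (C.rmulLin n l ^ m) x := by
  induction m with
  | zero => rfl
  | succ m ih => rw [pow_succ', Module.End.mul_apply, ← ih]; rfl

/-- Used with `s = 0` for continuity and with `s = 1` for contraction. -/
lemma rmul_smodEq {x x' : A n} {y y' : A 0} {r s : ℕ} (hx : x - x' ∈ C.fil r n)
    (hx' : x' ∈ C.fil s n) (hy : y ∈ C.fil s 0) (hyy : y - y' ∈ C.fil r 0) :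
    C.rmul x y - C.rmul x' y' ∈ C.fil (r + s) n := by
  have h : C.rmul x y - C.rmul x' y' = C.rmul (x - x') y + C.rmul x' (y - y') := by
    simp [rmul]
  rw [h]
  refine Submodule.add_mem _ (C.rmul_mem hx hy) ?_
  rw [add_comm]
  exact C.rmul_mem hx' hyy

lemma mem_fil_zero (x : A n) : x ∈ C.fil 0 n := by simp [C.fil_zero]

lemma rmulIter_sub_mem {x x' : A n} {y y' : A 0} {r : ℕ} (hx : x - x' ∈ C.fil r n)
    (hyy : y - y' ∈ C.fil r 0) (m : ℕ) : C.rmulIter x y m - C.rmulIter x' y' m ∈ C.fil r n := by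
  induction m with
  | zero => exact hx
  | succ m ih => exact C.rmul_smodEq (s := 0) ih (C.mem_fil_zero _) (C.mem_fil_zero _) hyy

lemma rmulIter_sub_mem_succ {x : A n} {y y' : A 0} {r : ℕ} (hx : x ∈ C.fil 1 n)
    (hy : y ∈ C.fil 1 0) (hy' : y' ∈ C.fil 1 0) (hyy : y - y' ∈ C.fil r 0) (m : ℕ) :
    C.rmulIter x y m - C.rmulIter x y' m ∈ C.fil (r + 1) n := by
  induction m with
  | zero => simp [rmulIter]
  | succ m ih =>
    exact C.rmul_smodEq (s := 1) (C.fil_succ_le _ _ ih)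
      (C.fil_anti n (Nat.le_add_right 1 m) (C.rmulIter_mem hx hy' m)) hy hyy

/-- The sum `∑ p_m ((x ⋆ l) ⋆ l) ⋯ ⋆ l` with `m` factors `l`. -/
noncomputable def rseries (p : PowerSeries k) (l : A 0) (x : A n) : A n :=
  C.sum fun m => PowerSeries.coeff m p • C.rmulIter x l m

lemma rmulIter_mem' (x : A n) {l : A 0} (hl : l ∈ C.fil 1 0) (m : ℕ) :
    C.rmulIter x l m ∈ C.fil m n := by
  simpa using C.rmulIter_mem (C.mem_fil_zero x) hl m

lemma isSum_rseries (p : PowerSeries k) {l : A 0} (hl : l ∈ C.fil 1 0) (x : A n) :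
    C.IsSum (fun m => PowerSeries.coeff m p • C.rmulIter x l m) (C.rseries p l x) :=
  C.isSum_sum fun m => Submodule.smul_mem _ _ (C.rmulIter_mem' x hl m)

lemma rseries_mem (p : PowerSeries k) {l : A 0} (hl : l ∈ C.fil 1 0) {x : A n} {r : ℕ}
    (hx : x ∈ C.fil r n) : C.rseries p l x ∈ C.fil r n :=
  (C.isSum_rseries p hl x).mem fun m => Submodule.smul_mem _ _
    (C.fil_anti n (Nat.le_add_right r m) (C.rmulIter_mem hx hl m))

lemma rseries_sub_mem (p : PowerSeries k) {l l' : A 0} (hl : l ∈ C.fil 1 0)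
    (hl' : l' ∈ C.fil 1 0) {x x' : A n} {r : ℕ} (hx : x - x' ∈ C.fil r n)
    (hll : l - l' ∈ C.fil r 0) : C.rseries p l x - C.rseries p l' x' ∈ C.fil r n :=
  (C.isSum_rseries p hl x).sub_mem (C.isSum_rseries p hl' x') fun m => by
    rw [← smul_sub]
    exact Submodule.smul_mem _ _ (C.rmulIter_sub_mem hx hll m)

/-- The contraction estimate: because `x` lies in `F_1`, changing `l` by `F_r` changes the value
only by `F_{r+1}`. Existence and uniqueness for the Magnus equation both rest on it. -/
lemma rseries_sub_mem_succ (p : PowerSeries k) {l l' : A 0} (hl : l ∈ C.fil 1 0)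
    (hl' : l' ∈ C.fil 1 0) {x : A n} {r : ℕ} (hx : x ∈ C.fil 1 n)
    (hll : l - l' ∈ C.fil r 0) : C.rseries p l x - C.rseries p l' x ∈ C.fil (r + 1) n :=
  (C.isSum_rseries p hl x).sub_mem (C.isSum_rseries p hl' x) fun m => by
    rw [← smul_sub]
    exact Submodule.smul_mem _ _ (C.rmulIter_sub_mem_succ hx hl hl' hll m)

/-- `rseries` as a linear map. -/
noncomputable def rseriesLin (n : ℤ) (p : PowerSeries k) {l : A 0} (hl : l ∈ C.fil 1 0) :
    Module.End k (A n) where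
  toFun := C.rseries p l
  map_add' x y := (C.isSum_rseries p hl (x + y)).unique (by
    simpa [rmulIter_eq] using (C.isSum_rseries p hl x).add (C.isSum_rseries p hl y))
  map_smul' c x := (C.isSum_rseries p hl (c • x)).unique (by
    simpa [rmulIter_eq, smul_comm _ c] using (C.isSum_rseries p hl x).map (LinearMap.lsmul k (A n) c)
      fun r _ => (C.fil r n).smul_mem c)

lemma rseriesLin_apply (p : PowerSeries k) {l : A 0} (hl : l ∈ C.fil 1 0) (x : A n) :
    C.rseriesLin n p hl x = C.rseries p l x := rfl

lemma rseries_mul (p q : PowerSeries k) {l : A 0} (hl : l ∈ C.fil 1 0) (x : A n) :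
    C.rseries (p * q) l x = C.rseries p l (C.rseries q l x) := by
  refine (C.isSum_rseries _ hl x).unique ?_
  have h := IsSum.antidiagonal (C := C)
    (b := fun i j => (PowerSeries.coeff i p * PowerSeries.coeff j q) • C.rmulIter x l (i + j))
    (s := fun j => C.rseries p l (PowerSeries.coeff j q • C.rmulIter x l j))
    (S := C.rseries p l (C.rseries q l x))
    (fun i j => Submodule.smul_mem _ _ (C.rmulIter_mem' x hl _))
    (fun j => by
      have h := C.isSum_rseries p hl (PowerSeries.coeff j q • C.rmulIter x l j)
      simpa only [rmulIter_eq, map_smul, ← Module.End.mul_apply, ← pow_add, smul_smul] using h)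
    ((C.isSum_rseries q hl x).map (C.rseriesLin n p hl) fun r x hx => C.rseries_mem p hl hx)
  convert h using 2 with m
  rw [PowerSeries.coeff_mul, Finset.sum_smul]
  refine Finset.sum_congr rfl fun y hy => ?_
  rw [mem_antidiagonal.1 hy]

lemma rseries_one (l : A 0) (x : A n) : C.rseries 1 l x = x := by
  have h := isSum_single (C := C)
    (x := fun m => PowerSeries.coeff m (1 : PowerSeries k) • C.rmulIter x l m) 0
    (fun j hj => by simp [PowerSeries.coeff_one, hj])
  have h' : PowerSeries.coeff 0 (1 : PowerSeries k) • C.rmulIter x l 0 = x := by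
    simp [rmulIter]
  rw [h'] at h
  exact (IsLim.unique C h (C.isLim_lim ⟨_, h⟩)).symm

lemma rseries_X {l : A 0} (hl : l ∈ C.fil 1 0) (x : A n) :
    C.rseries PowerSeries.X l x = C.rmul x l := by
  refine (C.isSum_rseries _ hl x).unique ?_
  have h := isSum_single (C := C)
    (x := fun m => PowerSeries.coeff m (PowerSeries.X : PowerSeries k) • C.rmulIter x l m) 1
    (fun j hj => by simp [PowerSeries.coeff_X, hj])
  simpa [rmulIter] using h

lemma rseries_add (p q : PowerSeries k) {l : A 0} (hl : l ∈ C.fil 1 0) (x : A n) :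
    C.rseries (p + q) l x = C.rseries p l x + C.rseries q l x := by
  refine (C.isSum_rseries _ hl x).unique ?_
  simpa [add_smul] using (C.isSum_rseries p hl x).add (C.isSum_rseries q hl x)

lemma rseries_zero_right (p : PowerSeries k) (x : A n) :
    C.rseries p 0 x = PowerSeries.coeff 0 p • x := by
  refine (C.isSum_rseries p (Submodule.zero_mem _) x).unique ?_
  exact isSum_single (C := C) (x := fun m => PowerSeries.coeff m p • C.rmulIter x 0 m) 0
    (fun j hj => by
      obtain ⟨i, rfl⟩ := Nat.exists_eq_succ_of_ne_zero hj
      simp [rmulIter, rmul])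

/-! ### Exponential and Magnus expansion -/

variable [CharZero k]

lemma exp_eq (l : A 0) : C.exp l = C.rseries (PowerSeries.exp k) l C.one := by
  simp only [exp, rseries, PowerSeries.coeff_exp_eq]

variable (k) in
/-- The power series `(exp(t) - 1) / t`. -/
noncomputable def expDiv : PowerSeries k := PowerSeries.mk fun m => ((m + 1)! : k)⁻¹

variable (k) in
lemma exp_eq_one_add_expDiv : PowerSeries.exp k = 1 + expDiv k * PowerSeries.X := by
  ext m
  rcases m with _ | m
  · simp
  · rw [map_add, PowerSeries.coeff_succ_mul_X, PowerSeries.coeff_exp_eq, expDiv,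
      PowerSeries.coeff_mk, PowerSeries.coeff_one, if_neg (by omega), zero_add]

variable (k) in
lemma bernoulliPowerSeries_mul_expDiv : bernoulliPowerSeries k * expDiv k = 1 := by
  have h := bernoulliPowerSeries_mul_exp_sub_one k
  rw [exp_eq_one_add_expDiv, add_sub_cancel_left, ← mul_assoc] at h
  exact mul_right_cancel₀ PowerSeries.X_ne_zero (h.trans (_root_.one_mul _).symm)

lemma exp_eq_one_add {l : A 0} (hl : l ∈ C.fil 1 0) :
    C.exp l = C.one + C.rseries (expDiv k) l l := by
  rw [exp_eq, exp_eq_one_add_expDiv, C.rseries_add _ _ hl, C.rseries_one, C.rseries_mul _ _ hl,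
    C.rseries_X hl, rmul, C.one_mul]

lemma exp_sub_one_mem {l : A 0} (hl : l ∈ C.fil 1 0) : C.exp l - C.one ∈ C.fil 1 0 := by
  rw [C.exp_eq_one_add hl, add_sub_cancel_left]
  exact C.rseries_mem _ hl hl

/-- The series `(e^t - 1) / t` and the Bernoulli series are mutually inverse, so each equation is
the other with an invertible operator moved across. -/
lemma exp_eq_one_add_iff {l y : A 0} (hl : l ∈ C.fil 1 0) :
    C.exp l = C.one + y ↔ l = C.rseries (bernoulliPowerSeries k) l y := by
  rw [C.exp_eq_one_add hl, add_right_inj]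
  constructor
  · rintro rfl
    rw [← C.rseries_mul _ _ hl, bernoulliPowerSeries_mul_expDiv, C.rseries_one]
  · intro h
    rw [congrArg (C.rseries (expDiv k) l) h, ← C.rseries_mul _ _ hl, mul_comm,
      bernoulliPowerSeries_mul_expDiv, C.rseries_one]

lemma magnusIter_succ (y : A 0) (r : ℕ) : C.magnusIter y (r + 1) =
    C.rseries (bernoulliPowerSeries k) (C.magnusIter y r) y := by
  simp only [magnusIter, rseries, bernoulliPowerSeries, PowerSeries.coeff_mk, eq_ratCast]

lemma magnusIter_mem {y : A 0} (hy : y ∈ C.fil 1 0) (r : ℕ) : C.magnusIter y r ∈ C.fil 1 0 := by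
  induction r with
  | zero => exact Submodule.zero_mem _
  | succ r ih =>
    rw [magnusIter_succ]
    exact C.rseries_mem _ ih hy

lemma isLim_magnus {y : A 0} (hy : y ∈ C.fil 1 0) : C.IsLim (C.magnusIter y) (C.magnus y) := by
  refine C.isLim_lim (C.exists_isLim fun r => ?_)
  induction r with
  | zero => exact C.mem_fil_zero _
  | succ r ih =>
    have h := C.rseries_sub_mem_succ (bernoulliPowerSeries k) (C.magnusIter_mem hy (r + 1))
      (C.magnusIter_mem hy r) hy ih
    rwa [← magnusIter_succ, ← magnusIter_succ] at h

lemma magnus_mem {y : A 0} (hy : y ∈ C.fil 1 0) : C.magnus y ∈ C.fil 1 0 :=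
  (C.isLim_magnus hy).mem (Filter.Eventually.of_forall (C.magnusIter_mem hy))

lemma magnus_eq {y : A 0} (hy : y ∈ C.fil 1 0) :
    C.magnus y = C.rseries (bernoulliPowerSeries k) (C.magnus y) y := by
  refine IsLim.unique C (a := fun r => C.magnusIter y (r + 1)) ?_ fun r => ?_
  · intro r
    obtain ⟨N, hN⟩ := C.isLim_magnus hy r
    exact ⟨N, fun m hm => hN _ (by omega)⟩
  · obtain ⟨N, hN⟩ := C.isLim_magnus hy r
    refine ⟨N, fun m hm => ?_⟩
    beta_reduce
    rw [magnusIter_succ]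
    exact C.rseries_sub_mem _ (C.magnus_mem hy) (C.magnusIter_mem hy _) (by simp) (hN m hm)

lemma exp_magnus {y : A 0} (hy : y ∈ C.fil 1 0) : C.exp (C.magnus y) = C.one + y :=
  (C.exp_eq_one_add_iff (C.magnus_mem hy)).2 (C.magnus_eq hy)

lemma exp_injOn {l l' : A 0} (hl : l ∈ C.fil 1 0) (hl' : l' ∈ C.fil 1 0)
    (h : C.exp l = C.exp l') : l = l' := by
  have hy := C.exp_sub_one_mem hl
  have h1 := (C.exp_eq_one_add_iff (y := C.exp l - C.one) hl).1 (by abel)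
  have h2 := (C.exp_eq_one_add_iff (y := C.exp l - C.one) hl').1 (by rw [← h]; abel)
  refine sub_eq_zero.1 (C.separated 0 _ fun r => ?_)
  induction r with
  | zero => exact C.mem_fil_zero _
  | succ r ih =>
    rw [h1, h2]
    exact C.rseries_sub_mem_succ _ hl hl' hy ih

lemma magnus_exp_sub_one {l : A 0} (hl : l ∈ C.fil 1 0) : C.magnus (C.exp l - C.one) = l := by
  have hy := C.exp_sub_one_mem hl
  refine C.exp_injOn (C.magnus_mem hy) hl ?_
  rw [C.exp_magnus hy]
  abel

lemma exp_sub_mem {l l' : A 0} (hl : l ∈ C.fil 1 0) (hl' : l' ∈ C.fil 1 0) {r : ℕ}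
    (h : l - l' ∈ C.fil r 0) : C.exp l - C.exp l' ∈ C.fil r 0 := by
  rw [exp_eq, exp_eq]
  exact C.rseries_sub_mem _ hl hl' (by simp) h

lemma magnus_sub_mem {y y' : A 0} (hy : y ∈ C.fil 1 0) (hy' : y' ∈ C.fil 1 0) {r : ℕ}
    (h : y - y' ∈ C.fil r 0) : C.magnus y - C.magnus y' ∈ C.fil r 0 := by
  refine (C.isLim_magnus hy).sub_mem (C.isLim_magnus hy') (Filter.Eventually.of_forall fun m => ?_)
  induction m with
  | zero => simp [magnusIter]
  | succ m ih =>
    rw [magnusIter_succ, magnusIter_succ]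
    exact C.rseries_sub_mem _ (C.magnusIter_mem hy _) (C.magnusIter_mem hy' _) h ih

end CompleteDGPreLieAlgebra

/-! ### Symmetry of the braces -/

namespace CompleteDGPreLieAlgebra

variable {k : Type*} [Field k] {A : ℤ → Type*} [∀ n, AddCommGroup (A n)] [∀ n, Module k (A n)]
  (C : CompleteDGPreLieAlgebra k A) {n : ℤ}

/-- The right action of an element of degree zero on multilinear maps. -/
def rightAct {m : ℕ} (β : MultilinearMap k (fun _ : Fin m => A 0) (A n)) (z : A 0) :
    MultilinearMap k (fun _ : Fin m => A 0) (A n) :=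
  (C.rmulLin n z).compMultilinearMap β -
    ∑ i, β.compLinearMap (Function.update (fun _ => LinearMap.id) i (C.rmulLin 0 z))

lemma rightAct_apply {m : ℕ} (β : MultilinearMap k (fun _ : Fin m => A 0) (A n)) (z : A 0)
    (y : Fin m → A 0) : C.rightAct β z y =
      C.rmul (β y) z - ∑ i, β (Function.update y i (C.rmul (y i) z)) := by
  rw [rightAct, sub_apply, sum_apply]
  refine congrArg₂ _ rfl (Finset.sum_congr rfl fun i _ => ?_)
  rw [MultilinearMap.compLinearMap_apply]
  congr 1
  ext j
  by_cases h : j = i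
  · subst h
    simp [rmulLin_apply]
  · simp [h]

lemma rmul_add_right (x : A n) (y z : A 0) : C.rmul x (y + z) = C.rmul x y + C.rmul x z :=
  map_add _ _ _

lemma rmul_smul_right (c : k) (x : A n) (y : A 0) : C.rmul x (c • y) = c • C.rmul x y :=
  map_smul _ _ _

lemma rightAct_add {m : ℕ} (β : MultilinearMap k (fun _ : Fin m => A 0) (A n)) (z w : A 0)
    (y : Fin m → A 0) : C.rightAct β (z + w) y = C.rightAct β z y + C.rightAct β w y := by
  simp only [rightAct_apply, rmul_add_right, MultilinearMap.map_update_add,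
    Finset.sum_add_distrib]
  abel

lemma rightAct_smul {m : ℕ} (β : MultilinearMap k (fun _ : Fin m => A 0) (A n)) (c : k) (z : A 0)
    (y : Fin m → A 0) : C.rightAct β (c • z) y = c • C.rightAct β z y := by
  simp only [rightAct_apply, rmul_smul_right, MultilinearMap.map_update_smul, smul_sub,
    Finset.smul_sum]

/-- The multilinear map `(y, z) ↦ (β · z)(y)`. -/
def extendAct {m : ℕ} (β : MultilinearMap k (fun _ : Fin m => A 0) (A n)) :
    MultilinearMap k (fun _ : Fin (m + 1) => A 0) (A n) :=
  MultilinearMap.uncurryRight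
    { toFun := fun y =>
        { toFun := fun z => C.rightAct β z y
          map_add' := fun z w => C.rightAct_add β z w y
          map_smul' := fun c z => C.rightAct_smul β c z y }
      map_update_add' := fun y i a b => LinearMap.ext fun z => by simp
      map_update_smul' := fun y i c a => LinearMap.ext fun z => by simp }

lemma extendAct_apply {m : ℕ} (β : MultilinearMap k (fun _ : Fin m => A 0) (A n))
    (y : Fin (m + 1) → A 0) :
    C.extendAct β y = C.rightAct β (y (Fin.last m)) (Fin.init y) := rfl

/-- The symmetric brace as a multilinear map. -/
def braceMul (x : A n) : (m : ℕ) → MultilinearMap k (fun _ : Fin m => A 0) (A n)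
  | 0 => MultilinearMap.constOfIsEmpty k _ x
  | m + 1 => C.extendAct (braceMul x m)

lemma braceMul_apply (x : A n) (m : ℕ) (y : Fin m → A 0) : C.braceMul x m y = C.brace m x y := by
  induction m with
  | zero => rfl
  | succ m ih => simp only [braceMul, extendAct_apply, rightAct_apply, ih, brace]

lemma rmul_preLie (x : A n) (y z : A 0) :
    C.rmul (C.rmul x y) z - C.rmul (C.rmul x z) y =
      C.rmul x (C.rmul y z) - C.rmul x (C.rmul z y) := by
  have h := C.preLie (add_zero n) (add_zero n) (add_zero 0) (add_zero n) (add_zero n)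
    (add_zero n) (add_zero 0) x y z
  simp only [mul_zero, Int.negOnePow_zero, one_smul] at h
  rw [sub_eq_sub_iff_add_eq_add] at h
  rw [sub_eq_sub_iff_add_eq_add, rmul, rmul, rmul, rmul, rmul, rmul, rmul, rmul, h]
  abel

lemma rmul_sub_left (x y : A n) (z : A 0) : C.rmul (x - y) z = C.rmul x z - C.rmul y z := by
  simp [rmul]

lemma rmul_sum_left {ι : Type*} (s : Finset ι) (x : ι → A n) (z : A 0) :
    C.rmul (∑ i ∈ s, x i) z = ∑ i ∈ s, C.rmul (x i) z := by
  simp [rmul]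

lemma sum_sum_sub_sum_sum {ι M : Type*} [Fintype ι] [AddCommGroup M] (F G : ι → ι → M)
    (h : ∀ i j, i ≠ j → F i j = G j i) :
    ∑ i, ∑ j, F i j - ∑ i, ∑ j, G i j = ∑ i, (F i i - G i i) := by
  rw [Finset.sum_comm (f := G), ← Finset.sum_sub_distrib]
  refine Finset.sum_congr rfl fun i _ => ?_
  rw [← Finset.sum_sub_distrib]
  refine Finset.sum_eq_single_of_mem i (Finset.mem_univ i) fun j _ hj => ?_
  rw [h i j hj.symm, sub_self]

/-- In the double sums, insertions of `a` and `b` in different slots cancel. The diagonal terms and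
the outer term are handled by the pre-Lie identity. -/
lemma rightAct_rightAct {m : ℕ} (β : MultilinearMap k (fun _ : Fin m => A 0) (A n)) (a b : A 0)
    (y : Fin m → A 0) :
    C.rightAct (C.rightAct β a) b y - C.rightAct (C.rightAct β b) a y =
      C.rightAct β (C.rmul a b) y - C.rightAct β (C.rmul b a) y := by
  simp only [rightAct_apply, rmul_sub_left, rmul_sum_left, Finset.sum_sub_distrib]
  have h1 := C.rmul_preLie (β y) a b
  have h2 := sum_sum_sub_sum_sum
    (fun j i => β (Function.update (Function.update y j (C.rmul (y j) b)) i
      (C.rmul (Function.update y j (C.rmul (y j) b) i) a)))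
    (fun j i => β (Function.update (Function.update y j (C.rmul (y j) a)) i
      (C.rmul (Function.update y j (C.rmul (y j) a) i) b))) (fun i j hij => by
        rw [Function.update_of_ne hij.symm, Function.update_of_ne hij, Function.update_comm hij])
  simp only [Function.update_self, Function.update_idem, ← MultilinearMap.map_update_sub,
    C.rmul_preLie _ b a] at h2
  simp only [MultilinearMap.map_update_sub, Finset.sum_sub_distrib] at h2
  rw [← sub_eq_zero] at h1 h2 ⊢
  have h := congrArg₂ (· + ·) h1 h2
  simp only [add_zero] at h
  rw [← h]
  abel

lemma extendAct_extendAct_apply {m : ℕ} (β : MultilinearMap k (fun _ : Fin m => A 0) (A n))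
    (y : Fin (m + 2) → A 0) : C.extendAct (C.extendAct β) y =
      C.rightAct (C.rightAct β (y (Fin.last m).castSucc)) (y (Fin.last (m + 1)))
        (Fin.init (Fin.init y)) -
      C.rightAct β (C.rmul (y (Fin.last m).castSucc) (y (Fin.last (m + 1))))
        (Fin.init (Fin.init y)) := by
  rw [extendAct_apply, rightAct_apply, Fin.sum_univ_castSucc, rightAct_apply, sub_sub]
  simp only [extendAct_apply, Fin.init_update_castSucc, Fin.init_update_last,
    Function.update_self]
  congr 2
  refine Finset.sum_congr rfl fun i _ => ?_
  rw [Function.update_of_ne (Fin.castSucc_lt_last i).ne']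
  rfl

lemma rightAct_comp_perm {m : ℕ} (β : MultilinearMap k (fun _ : Fin m => A 0) (A n))
    (hβ : ∀ (σ : Equiv.Perm (Fin m)) (y : Fin m → A 0), β (y ∘ σ) = β y) (z : A 0)
    (σ : Equiv.Perm (Fin m)) (y : Fin m → A 0) :
    C.rightAct β z (y ∘ σ) = C.rightAct β z y := by
  rw [rightAct_apply, rightAct_apply, hβ,
    ← Equiv.sum_comp σ fun i => β (Function.update y i (C.rmul (y i) z))]
  congr 1
  refine Finset.sum_congr rfl fun i _ => ?_
  rw [← hβ σ (Function.update y (σ i) _)]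
  congr 1
  ext j
  simp [Function.update_apply]

lemma extendAct_comp_perm {m : ℕ} (β : MultilinearMap k (fun _ : Fin m => A 0) (A n))
    (hβ : ∀ (σ : Equiv.Perm (Fin m)) (y : Fin m → A 0), β (y ∘ σ) = β y) {i j : Fin m}
    (y : Fin (m + 1) → A 0) :
    C.extendAct β (y ∘ Equiv.swap i.castSucc j.castSucc) = C.extendAct β y := by
  rw [extendAct_apply, extendAct_apply, ← C.rightAct_comp_perm β hβ _ (Equiv.swap i j) (Fin.init y)]
  congr 1
  · simp [Equiv.swap_apply_of_ne_of_ne (Fin.castSucc_lt_last i).ne' (Fin.castSucc_lt_last j).ne']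
  · ext l
    simp only [Fin.init, Function.comp_apply]
    rw [Fin.castSucc_injective m |>.map_swap]

/-- Adjacent transpositions suffice. Those fixing the last slot follow by induction. For the last
two entries `a, b` the brace is `(β · a) · b - β · (a ⋆ b)`, symmetric by `rightAct_rightAct`. -/
lemma braceMul_comp_perm (x : A n) (m : ℕ) (σ : Equiv.Perm (Fin m)) (y : Fin m → A 0) :
    C.braceMul x m (y ∘ σ) = C.braceMul x m y := by
  induction m with
  | zero => exact congrArg _ (Subsingleton.elim _ _)
  | succ m ih =>
    have hσ : σ ∈ Submonoid.closure
        (Set.range fun i : Fin m => Equiv.swap i.castSucc i.succ) := by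
      rw [Equiv.Perm.mclosure_swap_castSucc_succ]
      trivial
    induction hσ using Submonoid.closure_induction generalizing y with
    | one => rfl
    | mul σ τ _ _ hσ hτ =>
      rw [Equiv.Perm.coe_mul, ← Function.comp_assoc, hτ, hσ]
    | mem σ hσ =>
      obtain ⟨i, rfl⟩ := hσ
      rcases m with _ | m
      · exact i.elim0
      refine Fin.lastCases ?_ (fun i => ?_) i
      · simp only [braceMul, extendAct_extendAct_apply]
        have h : Fin.init (Fin.init (y ∘ Equiv.swap (Fin.last m).castSucc (Fin.last m).succ)) =
            Fin.init (Fin.init y) := by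
          ext l
          simp only [Fin.init, Function.comp_apply]
          rw [Equiv.swap_apply_of_ne_of_ne]
          · simp [Fin.ext_iff]
            omega
          · simp [Fin.ext_iff]
            omega
        rw [h]
        simp only [Function.comp_apply, Fin.succ_last, Equiv.swap_apply_left,
          Equiv.swap_apply_right]
        have h' := C.rightAct_rightAct (C.braceMul x m) (y (Fin.last m).castSucc)
          (y (Fin.last (m + 1))) (Fin.init (Fin.init y))
        rw [sub_eq_sub_iff_add_eq_add] at h' ⊢
        rw [add_comm, h', add_comm]
      · dsimp only
        rw [Fin.succ_castSucc]
        exact C.extendAct_comp_perm _ (fun σ y => ih σ y) y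

/-! ### Convolution of sequences through a multilinear map -/

section Conv

variable {d : ℕ} {P M : Type*} [AddCommGroup P] [Module k P] [AddCommGroup M] [Module k M]

/-- The coefficient of `t^m` in `β(∑ a_1(j) t^j, …, ∑ a_d(j) t^j)`. -/
def conv (β : MultilinearMap k (fun _ : Fin d => P) M) (a : Fin d → ℕ → P) (m : ℕ) : M :=
  ∑ f ∈ Finset.finAntidiagonal d m, β fun i => a i (f i)

lemma sum_update_succ (g : Fin d → ℕ) (i : Fin d) :
    ∑ j, Function.update g i (g i + 1) j = ∑ j, g j + 1 := by
  rw [Finset.sum_update_of_mem (Finset.mem_univ i),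
    Finset.sum_eq_add_sum_sdiff_singleton_of_mem (Finset.mem_univ i)]
  ring

lemma apply_update {P : Type*} (a : Fin d → ℕ → P) (i : Fin d) (b : ℕ → P) (g : Fin d → ℕ) :
    (fun j => Function.update a i b j (g j)) =
      Function.update (fun j => a j (g j)) i (b (g i)) := by
  ext j
  by_cases h : j = i
  · subst h
    simp
  · simp [h]

/-- The Leibniz rule for `d/dt`, read on coefficients: `m + 1` is distributed as the sum of the
exponents `f i`, and in the `i`-th sum the terms with `f i = 0` vanish. -/
lemma succ_smul_conv_succ (β : MultilinearMap k (fun _ : Fin d => P) M) (a : Fin d → ℕ → P)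
    (m : ℕ) : ((m + 1 : ℕ) : k) • conv β a (m + 1) =
      ∑ i, conv β (Function.update a i fun j => ((j + 1 : ℕ) : k) • a i (j + 1)) m := by
  have h : ((m + 1 : ℕ) : k) • conv β a (m + 1) =
      ∑ i, ∑ f ∈ Finset.finAntidiagonal d (m + 1), (f i : k) • β fun i => a i (f i) := by
    rw [Finset.sum_comm, conv, Finset.smul_sum]
    refine Finset.sum_congr rfl fun f hf => ?_
    rw [Finset.mem_finAntidiagonal] at hf
    rw [← Finset.sum_smul, ← hf, Nat.cast_sum]
  rw [h]
  refine Finset.sum_congr rfl fun i _ => ?_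
  symm
  refine Finset.sum_of_injOn (fun g => Function.update g i (g i + 1)) ?_ ?_ ?_ ?_
  · intro g _ g' _ hgg
    have h0 : ∀ j, Function.update g i (g i + 1) j = Function.update g' i (g' i + 1) j :=
      fun j => congrFun hgg j
    ext j
    by_cases hj : j = i
    · subst hj
      simpa using h0 j
    · simpa [hj] using h0 j
  · intro g hg
    simp only [Finset.mem_coe, Finset.mem_finAntidiagonal] at hg ⊢
    rw [sum_update_succ, hg]
  · intro f hf hf'
    rw [Finset.mem_finAntidiagonal] at hf
    have h0 : f i = 0 := by
      by_contra h0
      obtain ⟨c, hc⟩ := Nat.exists_eq_succ_of_ne_zero h0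
      refine hf' ⟨Function.update f i c, ?_, ?_⟩
      · have := sum_update_succ (Function.update f i c) i
        simp only [Function.update_self, Function.update_idem] at this
        rw [← Nat.succ_eq_add_one c, ← hc, Function.update_eq_self, hf] at this
        simp only [Finset.mem_coe, Finset.mem_finAntidiagonal]
        omega
      · simp [← Nat.succ_eq_add_one, ← hc]
    rw [h0, Nat.cast_zero, zero_smul]
  · intro g _
    rw [apply_update, MultilinearMap.map_update_smul, Function.update_self]
    congr 2
    ext j
    by_cases hj : j = i
    · subst hj
      simp
    · simp [hj]

lemma conv_comp_perm (β : MultilinearMap k (fun _ : Fin d => P) M)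
    (hβ : ∀ (σ : Equiv.Perm (Fin d)) (y : Fin d → P), β (y ∘ σ) = β y) (a : Fin d → ℕ → P)
    (σ : Equiv.Perm (Fin d)) (m : ℕ) : conv β (a ∘ σ) m = conv β a m := by
  refine Finset.sum_nbij' (fun f => f ∘ σ.symm) (fun f => f ∘ σ) ?_ ?_ ?_ ?_ ?_
  · intro f hf
    rw [Finset.mem_finAntidiagonal] at hf ⊢
    rw [← hf]
    exact Equiv.sum_comp σ.symm f
  · intro f hf
    rw [Finset.mem_finAntidiagonal] at hf ⊢
    rw [← hf]
    exact Equiv.sum_comp σ f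
  · intro f _
    ext
    simp
  · intro f _
    ext
    simp
  · intro f _
    rw [← hβ σ fun i => a i ((f ∘ σ.symm) i)]
    congr 1
    ext
    simp

lemma conv_update_add (β : MultilinearMap k (fun _ : Fin d => P) M) (a : Fin d → ℕ → P)
    (i : Fin d) (b c : ℕ → P) (m : ℕ) : conv β (Function.update a i fun j => b j + c j) m =
      conv β (Function.update a i b) m + conv β (Function.update a i c) m := by
  simp only [conv, apply_update, MultilinearMap.map_update_add, Finset.sum_add_distrib]

lemma conv_eq_zero_of_lt (β : MultilinearMap k (fun _ : Fin d => P) M) (a : Fin d → ℕ → P)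
    (ha : ∀ i, a i 0 = 0) {m : ℕ} (h : m < d) : conv β a m = 0 := by
  refine Finset.sum_eq_zero fun f hf => ?_
  rw [Finset.mem_finAntidiagonal] at hf
  obtain ⟨i, hi⟩ : ∃ i, f i = 0 := by
    by_contra! hne
    have := Finset.sum_le_sum fun i (_ : i ∈ Finset.univ) => Nat.one_le_iff_ne_zero.2 (hne i)
    simp at this
    omega
  exact β.map_coord_zero i (by rw [hi, ha])

lemma conv_update_last (β : MultilinearMap k (fun _ : Fin (d + 1) => P) M)
    (a : Fin (d + 1) → ℕ → P) (z : P) (m : ℕ) :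
    conv β (Function.update a (Fin.last d) fun j => if j = 0 then z else 0) m =
      ∑ g ∈ Finset.finAntidiagonal d m,
        β (Fin.snoc (α := fun _ => P) (fun i => a i.castSucc (g i)) z) := by
  symm
  refine Finset.sum_of_injOn (fun g => Fin.snoc (α := fun _ => ℕ) g 0) ?_ ?_ ?_ ?_
  · intro g _ g' _ hgg
    simpa using congrArg (Fin.init (α := fun _ => ℕ)) hgg
  · intro g hg
    simp only [Finset.mem_coe, Finset.mem_finAntidiagonal] at hg ⊢
    simp [Fin.sum_univ_castSucc, hg]
  · intro f hf hf'
    rw [Finset.mem_finAntidiagonal] at hf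
    have h0 : f (Fin.last d) ≠ 0 := by
      intro h0
      refine hf' ⟨Fin.init f, ?_, ?_⟩
      · simp only [Finset.mem_coe, Finset.mem_finAntidiagonal]
        rw [Fin.sum_univ_castSucc, h0, add_zero] at hf
        exact hf
      · rw [← h0]
        exact Fin.snoc_init_self f
    exact β.map_coord_zero (Fin.last d) (by simp [h0])
  · intro g _
    congr 1
    ext j
    refine Fin.lastCases ?_ (fun j => ?_) j
    · simp
    · simp

end Conv

end CompleteDGPreLieAlgebra

/-! ### The circle product with an exponential -/

namespace CompleteDGPreLieAlgebra

variable {k : Type*} [Field k] {A : ℤ → Type*} [∀ n, AddCommGroup (A n)] [∀ n, Module k (A n)]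
  (C : CompleteDGPreLieAlgebra k A) {n : ℤ}

lemma brace_sub_mem {x x' : A n} {r : ℕ} (hx : x - x' ∈ C.fil r n) (m : ℕ) {y y' : Fin m → A 0}
    (hy : ∀ i, y i - y' i ∈ C.fil r 0) : C.brace m x y - C.brace m x' y' ∈ C.fil r n := by
  induction m with
  | zero => exact hx
  | succ m ih =>
    rw [brace, brace, sub_sub_sub_comm, ← Finset.sum_sub_distrib]
    refine Submodule.sub_mem _ (C.rmul_smodEq (s := 0) (ih fun i => hy i.castSucc)
      (C.mem_fil_zero _) (C.mem_fil_zero _) (hy _))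
      (Submodule.sum_mem _ fun i _ => ih fun j => ?_)
    by_cases hj : j = i
    · subst hj
      simpa [Fin.init] using C.rmul_smodEq (s := 0) (hy j.castSucc)
        (C.mem_fil_zero _) (C.mem_fil_zero _) (hy (Fin.last m))
    · simpa [hj, Fin.init] using hy j.castSucc

/-- The terms `l^{⋆j} / j!` of positive degree of the exponential series. -/
def expTerm (l : A 0) : ℕ → A 0
  | 0 => 0
  | j + 1 => ((j + 1)! : k)⁻¹ • C.rmulIter C.one l (j + 1)

lemma expTerm_mem {l : A 0} (hl : l ∈ C.fil 1 0) (j : ℕ) : C.expTerm l j ∈ C.fil j 0 := by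
  rcases j with _ | j
  · exact Submodule.zero_mem _
  · exact Submodule.smul_mem _ _ (C.rmulIter_mem' _ hl _)

lemma isSum_expTerm {l : A 0} (hl : l ∈ C.fil 1 0) :
    C.IsSum (C.expTerm l) (C.exp l - C.one) := by
  have h := (C.isSum_exp hl).sub (isSum_single (C := C) (x := fun m => if m = 0 then C.one else 0)
    0 fun j hj => if_neg hj)
  rw [if_pos rfl] at h
  convert h using 2 with m
  rcases m with _ | m
  · simp [expTerm, rmulIter]
  · simp [expTerm]

/-- The sum of the braces of total degree `m` with `d` entries `l^{⋆j} / j!`. -/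
def braceConv (x : A n) (l : A 0) (d m : ℕ) : A n :=
  conv (C.braceMul x d) (fun _ => C.expTerm l) m

/-- The sum of the braces of total degree `m` with `d` entries `l^{⋆j} / j!`, one of them
multiplied by `l`. -/
def braceConvMul (x : A n) (l : A 0) (d m : ℕ) : A n :=
  ∑ i, conv (C.braceMul x d)
    (Function.update (fun _ => C.expTerm l) i fun j => C.rmul (C.expTerm l j) l) m

lemma conv_update_last_expTerm (x : A n) (l : A 0) (d m : ℕ) :
    conv (C.braceMul x (d + 1)) (Function.update (fun _ => C.expTerm l) (Fin.last d)
      fun j => if j = 0 then l else 0) m =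
      C.rmul (C.braceConv x l d m) l - C.braceConvMul x l d m := by
  rw [conv_update_last, braceConv, braceConvMul, conv, rmul_sum_left]
  simp only [conv, apply_update]
  rw [Finset.sum_comm, ← Finset.sum_sub_distrib]
  refine Finset.sum_congr rfl fun g _ => ?_
  rw [braceMul, extendAct_apply, rightAct_apply, Fin.snoc_last, Fin.init_snoc]

lemma succ_smul_braceConv_zero_succ (x : A n) (l : A 0) (m : ℕ) :
    ((m + 1 : ℕ) : k) • C.braceConv x l 0 (m + 1) = C.braceConvMul x l 0 m := by
  rw [braceConv, succ_smul_conv_succ, braceConvMul]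
  rfl

lemma braceMul_expTerm_mem (x : A n) {l : A 0} (hl : l ∈ C.fil 1 0) {d : ℕ} (f : Fin d → ℕ) :
    C.braceMul x d (fun i => C.expTerm l (f i)) ∈ C.fil (∑ i, f i) n := by
  rw [braceMul_apply]
  exact C.brace_mem_sum d x f _ fun i => C.expTerm_mem hl _

lemma braceMul_sum_expTerm_smodEq (x : A n) {l : A 0} (hl : l ∈ C.fil 1 0) (d N : ℕ) :
    C.braceMul x d (fun _ => ∑ j ∈ Finset.range N, C.expTerm l j) ≡
      ∑ m ∈ Finset.range N, C.braceConv x l d m [SMOD C.fil N n] := by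
  rw [MultilinearMap.map_sum_finset]
  -- Index tuples of total degree at least `N` contribute to `F_N`; the others are grouped by total
  -- degree.
  rw [← Finset.sum_filter_add_sum_filter_not _ fun f : Fin d → ℕ => ∑ i, f i < N]
  have h : ∑ f ∈ Fintype.piFinset (fun _ : Fin d => Finset.range N) with ∑ i, f i < N,
      C.braceMul x d (fun i => C.expTerm l (f i)) =
      ∑ m ∈ Finset.range N, C.braceConv x l d m := by
    rw [← Finset.sum_fiberwise_of_maps_to (t := Finset.range N) (g := fun f => ∑ i, f i)
      (fun f hf => by simpa using (Finset.mem_filter.1 hf).2)]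
    refine Finset.sum_congr rfl fun m hm => Finset.sum_congr ?_ fun _ _ => rfl
    ext f
    simp only [Finset.mem_filter, Fintype.mem_piFinset, Finset.mem_range,
      Finset.mem_finAntidiagonal] at hm ⊢
    constructor
    · exact fun h => h.2
    · rintro rfl
      exact ⟨⟨fun i => (Finset.single_le_sum (fun _ _ => Nat.zero_le _)
        (Finset.mem_univ i)).trans_lt hm, hm⟩, rfl⟩
  rw [h]
  conv_rhs => rw [← add_zero (∑ m ∈ Finset.range N, C.braceConv x l d m)]
  refine SModEq.add rfl (SModEq.zero.2 (Submodule.sum_mem _ fun f hf => ?_))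
  exact C.fil_anti n (not_lt.1 (Finset.mem_filter.1 hf).2) (C.braceMul_expTerm_mem x hl f)

variable [CharZero k]

/-- The equation `E' = E ⋆ l + l` for `E(t) = exp(tl) - 1`, coefficientwise. -/
lemma succ_smul_expTerm_succ (l : A 0) (j : ℕ) : ((j + 1 : ℕ) : k) • C.expTerm l (j + 1) =
    C.rmul (C.expTerm l j) l + if j = 0 then l else 0 := by
  have h : ((j + 1 : ℕ) : k) • C.expTerm l (j + 1) =
      (j ! : k)⁻¹ • C.rmul (C.rmulIter C.one l j) l := by
    rw [expTerm, smul_smul, Nat.factorial_succ, Nat.cast_mul, mul_inv_rev, mul_comm, mul_assoc,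
      inv_mul_cancel₀ (Nat.cast_ne_zero.2 j.succ_ne_zero), mul_one]
    rfl
  rw [h]
  rcases j with _ | j
  · simp [expTerm, rmulIter, rmul, C.one_mul]
  · simp [expTerm, rmul]

lemma succ_smul_braceConv_succ_succ (x : A n) (l : A 0) (d m : ℕ) :
    ((m + 1 : ℕ) : k) • C.braceConv x l (d + 1) (m + 1) = C.braceConvMul x l (d + 1) m +
      ((d + 1 : ℕ) : k) • (C.rmul (C.braceConv x l d m) l - C.braceConvMul x l d m) := by
  rw [braceConv, succ_smul_conv_succ]
  simp only [C.succ_smul_expTerm_succ, conv_update_add]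
  rw [Finset.sum_add_distrib, ← C.conv_update_last_expTerm]
  congr 1
  refine (Finset.sum_eq_card_nsmul (b := conv (C.braceMul x (d + 1)) (Function.update
    (fun _ => C.expTerm l) (Fin.last d) fun j => if j = 0 then l else 0) m) fun i _ => ?_).trans
    (by rw [Nat.cast_smul_eq_nsmul, Finset.card_univ, Fintype.card_fin])
  -- Symmetry of the braces moves the entry `l` from slot `i` to the last slot, so the `d + 1` terms
  -- are equal.
  rw [← conv_comp_perm _ (C.braceMul_comp_perm x (d + 1)) _ (Equiv.swap i (Fin.last d))]
  congr 1
  ext j : 1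
  by_cases hj : j = Fin.last d
  · subst hj
    by_cases hi : i = Fin.last d
    · subst hi
      simp
    · simp
  · by_cases hi : j = i
    · subst hi
      simp [Function.update_of_ne (Ne.symm hj), Function.update_of_ne hj]
    · rw [Function.comp_apply, Equiv.swap_apply_of_ne_of_ne hi hj]
      simp [hi, hj]

/-- After division by `d!` the `braceConvMul` terms telescope in `d`, and what remains is the
equation `f' = f ⋆ l` that `e^{t R_l}(x)` satisfies. -/
lemma sum_braceConv (x : A n) (l : A 0) (m : ℕ) :
    ∑ d ∈ Finset.range (m + 1), (d ! : k)⁻¹ • C.braceConv x l d m =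
      (m ! : k)⁻¹ • C.rmulIter x l m := by
  induction m with
  | zero =>
    have h : Finset.finAntidiagonal 0 0 = {(0 : Fin 0 → ℕ)} := by
      ext f
      simp [Subsingleton.elim f 0]
    simp [braceConv, conv, rmulIter, braceMul, h]
  | succ m ih =>
    have hm : ((m + 1 : ℕ) : k) ≠ 0 := Nat.cast_ne_zero.2 m.succ_ne_zero
    have h : ((m + 1 : ℕ) : k) • ∑ d ∈ Finset.range (m + 2), (d ! : k)⁻¹ •
        C.braceConv x l d (m + 1) = C.rmul ((m ! : k)⁻¹ • C.rmulIter x l m) l := by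
      rw [Finset.smul_sum, Finset.sum_range_succ']
      simp only [smul_comm ((m + 1 : ℕ) : k), succ_smul_braceConv_zero_succ,
        succ_smul_braceConv_succ_succ, smul_add, Finset.sum_add_distrib]
      have h1 : ∀ d : ℕ, ((d + 1)! : k)⁻¹ • ((d + 1 : ℕ) : k) •
          (C.rmul (C.braceConv x l d m) l - C.braceConvMul x l d m) =
          C.rmul ((d ! : k)⁻¹ • C.braceConv x l d m) l - (d ! : k)⁻¹ • C.braceConvMul x l d m := by
        intro d
        have hd : ((d + 1 : ℕ) : k) ≠ 0 := Nat.cast_ne_zero.2 d.succ_ne_zero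
        rw [smul_smul, Nat.factorial_succ, Nat.cast_mul, mul_inv_rev, mul_assoc,
          inv_mul_cancel₀ hd, mul_one, smul_sub]
        simp [rmul]
      simp only [h1, Finset.sum_sub_distrib]
      rw [← rmul_sum_left, ih, add_right_comm, ← Finset.sum_range_succ'
        (fun d => (d ! : k)⁻¹ • C.braceConvMul x l d m), Finset.sum_range_succ _ (m + 1)]
      -- The surviving end of the telescope has `m + 1` entries, each of degree at least one, but
      -- total degree `m`.
      have h0 : C.braceConvMul x l (m + 1) m = 0 := by
        refine Finset.sum_eq_zero fun i _ => conv_eq_zero_of_lt _ _ (fun j => ?_) (by omega)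
        by_cases hj : j = i
        · subst hj
          simp [expTerm, rmul]
        · simp [hj, expTerm]
      rw [h0, smul_zero, add_zero]
      abel
    rw [← smul_right_injective (A n) hm |>.eq_iff]
    rw [h, Nat.factorial_succ, Nat.cast_mul, mul_inv_rev, mul_comm, smul_smul, ← mul_assoc,
      mul_inv_cancel₀ hm, _root_.one_mul]
    simp [rmul, rmulIter]

theorem circ_exp (x : A n) {l : A 0} (hl : l ∈ C.fil 1 0) :
    C.circ x (C.exp l - C.one) = C.rseries (PowerSeries.exp k) l x := by
  have hy := C.exp_sub_one_mem hl
  refine eq_of_smodEq (C := C) fun N => ?_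
  refine ((C.isSum_circ x hy).smodEq (fun m => Submodule.smul_mem _ _
    (C.brace_mem m x _ fun _ => hy)) N).trans ?_
  refine SModEq.trans ?_ ((C.isSum_rseries _ hl x).smodEq (fun m => Submodule.smul_mem _ _
    (C.rmulIter_mem' x hl m)) N).symm
  have h1 : ∑ d ∈ Finset.range N, (d ! : k)⁻¹ • C.brace d x (fun _ => C.exp l - C.one) ≡
      ∑ d ∈ Finset.range N, (d ! : k)⁻¹ • ∑ m ∈ Finset.range N, C.braceConv x l d m
      [SMOD C.fil N n] := by
    refine SModEq.sum fun d _ => SModEq.smul (SModEq.trans ?_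
      (C.braceMul_sum_expTerm_smodEq x hl d N)) _
    rw [braceMul_apply, SModEq.sub_mem]
    exact C.brace_sub_mem (by simp) d fun _ =>
      SModEq.sub_mem.1 ((C.isSum_expTerm hl).smodEq (C.expTerm_mem hl) N)
  refine h1.trans ?_
  simp only [Finset.smul_sum]
  rw [Finset.sum_comm]
  refine SModEq.sum fun m hm => ?_
  rw [PowerSeries.coeff_exp_eq, ← C.sum_braceConv]
  rw [Finset.mem_range] at hm
  rw [Finset.sum_subset (Finset.range_subset_range.2 (show m + 1 ≤ N by omega))]
  intro d _ hd
  rw [braceConv, conv_eq_zero_of_lt _ _ (fun _ => rfl) (by simpa using hd), smul_zero]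

end CompleteDGPreLieAlgebra

/-! ### The exponential of the Baker-Campbell-Hausdorff series -/

namespace CompleteDGPreLieAlgebra

variable {k : Type*} [Field k] {A : ℤ → Type*} [∀ n, AddCommGroup (A n)] [∀ n, Module k (A n)]
  (C : CompleteDGPreLieAlgebra k A) {n : ℤ}

lemma lie_mem {x y : C.fil 1 0} {s : ℕ} (hy : (y : A 0) ∈ C.fil s 0) :
    ((⁅x, y⁆ : C.fil 1 0) : A 0) ∈ C.fil (s + 1) 0 := by
  rw [coe_bracket]
  refine Submodule.sub_mem _ ?_ (C.rmul_mem hy x.2)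
  rw [add_comm]
  exact C.rmul_mem x.2 hy

/-- The filtration of `k × Lie` induced by the evaluation of Lie polynomials at `x` and `y`. -/
def dynkinFil (x y : C.fil 1 0) (s : ℕ) : Submodule k (k × FreeLieAlgebra k (Fin 2)) where
  carrier := {v | (s ≠ 0 → v.1 = 0) ∧
    ((FreeLieAlgebra.lift k ![x, y] v.2 : C.fil 1 0) : A 0) ∈ C.fil s 0}
  add_mem' := fun {v w} hv hw => ⟨fun hs => by simp [hv.1 hs, hw.1 hs], by
    rw [Prod.snd_add, map_add, Submodule.coe_add]
    exact Submodule.add_mem _ hv.2 hw.2⟩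
  zero_mem' := ⟨fun _ => rfl, by simp⟩
  smul_mem' := fun c v hv => ⟨fun hs => by simp [hv.1 hs], by
    rw [Prod.smul_snd, map_smul, Submodule.coe_smul]
    exact Submodule.smul_mem _ _ hv.2⟩

lemma dynkinRep_ι_mem (x y : C.fil 1 0) (i : Fin 2) {s : ℕ} {v : k × FreeLieAlgebra k (Fin 2)}
    (hv : v ∈ C.dynkinFil x y s) :
    dynkinRep k (FreeAlgebra.ι k i) v ∈ C.dynkinFil x y (s + 1) := by
  rw [dynkinRep_ι_apply]
  refine ⟨fun _ => rfl, ?_⟩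
  rcases Nat.eq_zero_or_pos s with rfl | hs
  -- At level zero the scalar part may be nonzero, but any Lie polynomial evaluates into `F_1`.
  · exact Subtype.property _
  · rw [hv.1 hs.ne', zero_smul, zero_add, LieHom.map_lie]
    exact C.lie_mem hv.2

/-! ### Right multiplication as a Lie algebra representation -/

section

open MulOpposite

attribute [local instance] LieRing.ofAssociativeRing

/-- The right multiplications as a representation of the Lie algebra of gauges. -/
def rmulLie (n : ℤ) : C.fil 1 0 →ₗ⁅k⁆ (Module.End k (A n))ᵐᵒᵖ where
  toFun l := op (C.rmulLin n l)
  map_add' l l' := by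
    rw [← op_add]
    exact congrArg op (LinearMap.ext fun v => C.rmul_add_right v _ _)
  map_smul' c l := by
    rw [← op_smul]
    exact congrArg op (LinearMap.ext fun v => C.rmul_smul_right c v _)
  map_lie' := fun {l l'} => by
    rw [Ring.lie_def, ← op_mul, ← op_mul, ← op_sub]
    refine congrArg op (LinearMap.ext fun v => ?_)
    have h := C.rmul_preLie v (l : A 0) (l' : A 0)
    rw [coe_bracket, rmulLin_apply]
    simp only [rmul, map_sub] at h ⊢
    exact h.symm

/-- The algebra map that sends the two generators to the right multiplications by `x` and `y`. -/
noncomputable def rmulHom (n : ℤ) (x y : C.fil 1 0) :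
    FreeAlgebra k (Fin 2) →ₐ[k] (Module.End k (A n))ᵐᵒᵖ :=
  FreeAlgebra.lift k fun i => C.rmulLie n (![x, y] i)

/-- Both sides are Lie morphisms in `l` that agree on generators. -/
lemma rmulHom_lieToAssoc (n : ℤ) (x y : C.fil 1 0) (l : FreeLieAlgebra k (Fin 2)) :
    C.rmulHom n x y (lieToAssoc k l) =
      op (C.rmulLin n (FreeLieAlgebra.lift k ![x, y] l : C.fil 1 0)) := by
  have h : (AlgHom.toLieHom (C.rmulHom n x y)).comp
      (FreeLieAlgebra.lift k (FreeAlgebra.ι k)) =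
      (C.rmulLie n).comp (FreeLieAlgebra.lift k ![x, y]) := by
    refine FreeLieAlgebra.hom_ext fun i => ?_
    simp [FreeLieAlgebra.lift_of_apply, rmulHom]
  exact LieHom.congr_fun h l

end

/-! ### Filtered operator series and their values at `t = 1` -/

section OperatorSeries

open PowerSeries MulOpposite

/-- The coefficient of `t^m` raises the filtration by `m`. -/
def IsFiltered (f : PowerSeries (Module.End k (A n))ᵐᵒᵖ) : Prop :=
  ∀ m r v, v ∈ C.fil r n → unop (coeff m f) v ∈ C.fil (r + m) n

/-- The value at `t = 1` of a filtered series of operators. -/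
noncomputable def opEval (f : PowerSeries (Module.End k (A n))ᵐᵒᵖ) (v : A n) : A n :=
  C.sum fun m => unop (coeff m f) v

variable {C}

lemma IsFiltered.mem {f : PowerSeries (Module.End k (A n))ᵐᵒᵖ} (hf : C.IsFiltered f) (m : ℕ)
    (v : A n) : unop (coeff m f) v ∈ C.fil m n := by
  simpa using hf m 0 v (C.mem_fil_zero v)

lemma IsFiltered.isSum {f : PowerSeries (Module.End k (A n))ᵐᵒᵖ} (hf : C.IsFiltered f)
    (v : A n) : C.IsSum (fun m => unop (coeff m f) v) (C.opEval f v) :=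
  C.isSum_sum fun m => hf.mem m v

lemma unop_coeff_mul_apply (f g : PowerSeries (Module.End k (A n))ᵐᵒᵖ) (m : ℕ) (v : A n) :
    unop (coeff m (f * g)) v =
      ∑ p ∈ antidiagonal m, unop (coeff p.2 g) (unop (coeff p.1 f) v) := by
  rw [coeff_mul, Finset.unop_sum, LinearMap.sum_apply]
  rfl

lemma IsFiltered.mul {f g : PowerSeries (Module.End k (A n))ᵐᵒᵖ} (hf : C.IsFiltered f)
    (hg : C.IsFiltered g) : C.IsFiltered (f * g) := by
  intro m r v hv
  rw [unop_coeff_mul_apply]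
  refine Submodule.sum_mem _ fun p hp => ?_
  rw [← mem_antidiagonal.1 hp, ← add_assoc]
  exact hg _ _ _ (hf _ _ _ hv)

lemma IsFiltered.one : C.IsFiltered (1 : PowerSeries (Module.End k (A n))ᵐᵒᵖ) := by
  intro m r v hv
  rw [coeff_one]
  split_ifs with h
  · subst h
    exact hv
  · exact Submodule.zero_mem _

lemma IsFiltered.pow {f : PowerSeries (Module.End k (A n))ᵐᵒᵖ} (hf : C.IsFiltered f) (d : ℕ) :
    C.IsFiltered (f ^ d) := by
  induction d with
  | zero => exact IsFiltered.one
  | succ d ih => exact ih.mul hf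

/-- The order of composition is reversed because the coefficients live in the opposite algebra. -/
lemma opEval_mul {f g : PowerSeries (Module.End k (A n))ᵐᵒᵖ} (hf : C.IsFiltered f)
    (hg : C.IsFiltered g) (v : A n) : C.opEval (f * g) v = C.opEval g (C.opEval f v) := by
  refine ((hf.mul hg).isSum v).unique ?_
  simp only [unop_coeff_mul_apply]
  refine IsSum.antidiagonal (C := C) (b := fun i j => unop (coeff j g) (unop (coeff i f) v))
    (s := fun j => unop (coeff j g) (C.opEval f v))
    (fun i j => hg _ _ _ (hf.mem i v)) (fun j => ?_) (hg.isSum _)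
  exact (hf.isSum v).map (unop (coeff j g)) fun r x hx =>
    C.fil_anti n (Nat.le_add_right r j) (hg j r x hx)

lemma opEval_one (v : A n) : C.opEval 1 v = v := by
  refine (IsFiltered.one.isSum v).unique ?_
  have h := isSum_single (C := C)
    (x := fun m => unop (coeff m (1 : PowerSeries (Module.End k (A n))ᵐᵒᵖ)) v) 0 fun j hj => by
      rw [coeff_one, if_neg hj]
      rfl
  rwa [coeff_one, if_pos rfl] at h

variable (C)

lemma unop_coeff_evalSeries_monomial (p : PowerSeries k) (l : A 0) (m : ℕ) (v : A n) :
    unop (coeff m (evalSeries (monomial 1 (op (C.rmulLin n l))) p)) v =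
      coeff m p • C.rmulIter v l m := by
  rw [evalSeries_monomial, coeff_mk, rmulIter_eq]
  rfl

lemma isFiltered_evalSeries_monomial (p : PowerSeries k) {l : A 0} (hl : l ∈ C.fil 1 0) :
    C.IsFiltered (evalSeries (monomial 1 (op (C.rmulLin n l))) p) := by
  intro m r v hv
  rw [unop_coeff_evalSeries_monomial]
  exact Submodule.smul_mem _ _ (C.rmulIter_mem hv hl m)

lemma opEval_evalSeries_monomial (p : PowerSeries k) (l : A 0) (v : A n) :
    C.opEval (evalSeries (monomial 1 (op (C.rmulLin n l))) p) v = C.rseries p l v := by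
  simp only [opEval, unop_coeff_evalSeries_monomial, rseries]

end OperatorSeries

variable [CharZero k]

/-- Each letter of a Dynkin word raises the level of `dynkinFil` by one, starting from `(1, 0)` at
level zero. This is what makes the series converge. -/
lemma bchTerm_mem (x y : C.fil 1 0) (n : ℕ) : C.bchTerm x y n ∈ C.fil n 0 := by
  let W : ℕ → Submodule k (FreeAlgebra k (Fin 2)) := fun n =>
    { carrier := {u | ∀ s, ∀ v ∈ C.dynkinFil x y s, dynkinRep k u v ∈ C.dynkinFil x y (s + n)}
      add_mem' := fun {u w} hu hw s v hv => by
        rw [map_add]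
        exact Submodule.add_mem _ (hu s v hv) (hw s v hv)
      zero_mem' := fun s v _ => by
        rw [map_zero]
        exact Submodule.zero_mem _
      smul_mem' := fun c u hu s v hv => by
        rw [map_smul]
        exact Submodule.smul_mem _ _ (hu s v hv) }
  have h : bchAssoc k n ∈ W n := by
    refine bchAssoc_mem k (W := W) ?_ ?_ ?_ n
    · intro s v hv
      rw [map_one]
      exact hv
    · intro i j a b ha hb s v hv
      rw [map_mul, Module.End.mul_apply, add_comm i j, ← add_assoc]
      exact ha _ _ (hb _ _ hv)
    · exact fun i s v hv => C.dynkinRep_ι_mem x y i hv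
  have h' := h 0 (1, 0) ⟨fun h => absurd rfl h, C.mem_fil_zero _⟩
  rw [zero_add] at h'
  rw [bchTerm, bchLie, map_smul, Submodule.coe_smul, dynkinMap_apply]
  exact Submodule.smul_mem _ _ h'.2

lemma isSum_bch (x y : C.fil 1 0) : C.IsSum (C.bchTerm x y) (C.bch x y) :=
  C.isSum_sum (C.bchTerm_mem x y)

lemma bch_mem (x y : C.fil 1 0) : C.bch x y ∈ C.fil 1 0 :=
  (C.isSum_bch x y).mem fun _ => Subtype.property _

/-! ### The exponential of right multiplication by a Baker–Campbell–Hausdorff sum -/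

section

open PowerSeries MulOpposite

lemma map_rmulHom_expGen (x y : C.fil 1 0) (i : Fin 2) :
    PowerSeries.map (RingHomClass.toRingHom (C.rmulHom n x y)) (expGen k i) =
      evalSeries (monomial 1 (op (C.rmulLin n (![x, y] i : C.fil 1 0)))) (PowerSeries.exp k) := by
  rw [expGen, map_evalSeries, PowerSeries.map_monomial, RingHom.coe_coe, rmulHom,
    FreeAlgebra.lift_ι_apply]
  rfl

lemma coeff_map_rmulHom_bchSeries (x y : C.fil 1 0) (m : ℕ) :
    coeff m (PowerSeries.map (RingHomClass.toRingHom (C.rmulHom n x y)) (bchSeries k)) =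
      op (C.rmulLin n (C.bchTerm x y m)) := by
  rw [coeff_map, bchSeries, coeff_mk, ← lieToAssoc_bchLie, RingHom.coe_coe, rmulHom_lieToAssoc,
    bchTerm]

theorem rseries_exp_bch (x y : C.fil 1 0) (v : A n) :
    C.rseries (PowerSeries.exp k) (C.bch x y) v =
      C.rseries (PowerSeries.exp k) (y : A 0) (C.rseries (PowerSeries.exp k) (x : A 0) v) := by
  -- At `t = 1` the series `Z` becomes right multiplication by `BCH(x, y)`, while `exp(Z)` factors
  -- formally; the two are compared modulo each `F_N`.
  set Z := PowerSeries.map (RingHomClass.toRingHom (C.rmulHom n x y)) (bchSeries k) with hZ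
  have hZ0 : constantCoeff Z = 0 := by
    rw [hZ, ← coeff_zero_eq_constantCoeff_apply, coeff_map, coeff_zero_eq_constantCoeff_apply,
      constantCoeff_bchSeries, map_zero]
  have hZf : C.IsFiltered Z := by
    intro m r v hv
    rw [hZ, coeff_map_rmulHom_bchSeries]
    exact C.rmul_mem hv (C.bchTerm_mem x y m)
  have hZv : ∀ v, C.opEval Z v = C.rmulLin n (C.bch x y) v := by
    intro v
    refine (hZf.isSum v).unique ?_
    simp only [hZ, coeff_map_rmulHom_bchSeries]
    exact (C.isSum_bch x y).map (C.mul (add_zero n) v) fun r l hl => by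
      simpa using C.mul_mem (add_zero n) (C.mem_fil_zero v) hl
  have hZd : ∀ d, C.opEval (Z ^ d) v = C.rmulIter v (C.bch x y) d := by
    intro d
    induction d with
    | zero => exact opEval_one v
    | succ d ih => rw [pow_succ, opEval_mul (hZf.pow d) hZf, ih, hZv]; rfl
  have hexp : evalSeries Z (PowerSeries.exp k) =
      evalSeries (monomial 1 (op (C.rmulLin n (x : A 0)))) (PowerSeries.exp k) *
        evalSeries (monomial 1 (op (C.rmulLin n (y : A 0)))) (PowerSeries.exp k) := by
    rw [hZ, ← map_evalSeries, evalSeries_bchSeries_exp, map_mul, map_rmulHom_expGen,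
      map_rmulHom_expGen]
    rfl
  have hx := C.isFiltered_evalSeries_monomial (n := n) (PowerSeries.exp k) x.2
  have hy := C.isFiltered_evalSeries_monomial (n := n) (PowerSeries.exp k) y.2
  have h := (hx.mul hy).isSum v
  rw [opEval_mul hx hy, opEval_evalSeries_monomial, opEval_evalSeries_monomial, ← hexp] at h
  refine (IsSum.unique h (isSum_of_smodEq fun N => ?_)).symm
  refine ((C.isSum_rseries (PowerSeries.exp k) (C.bch_mem x y) v).smodEq
    (fun m => Submodule.smul_mem _ _ (C.rmulIter_mem' v (C.bch_mem x y) m)) N).trans ?_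
  have h2 : ∀ m ∈ Finset.range N, unop (coeff m (evalSeries Z (PowerSeries.exp k))) v =
      ∑ d ∈ Finset.range N, coeff d (PowerSeries.exp k) • unop (coeff m (Z ^ d)) v := by
    intro m hm
    rw [coeff_evalSeries hZ0 _ (Finset.mem_range.1 hm), Finset.unop_sum, LinearMap.sum_apply]
    rfl
  rw [Finset.sum_congr rfl h2, Finset.sum_comm]
  refine SModEq.sum fun d _ => ?_
  rw [← Finset.smul_sum, ← hZd]
  exact SModEq.smul (((hZf.pow d).isSum v).smodEq ((hZf.pow d).mem · v) N) _

end

end CompleteDGPreLieAlgebra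

/-! ### The gauge action as a conjugation -/

namespace CompleteDGPreLieAlgebra

variable {k : Type*} [Field k] {A : ℤ → Type*} [∀ n, AddCommGroup (A n)] [∀ n, Module k (A n)]
  (C : CompleteDGPreLieAlgebra k A) {n : ℤ}

lemma IsSum.shift {C : CompleteDGPreLieAlgebra k A} {x : ℕ → A n} {s : A n}
    (h : C.IsSum (fun m => x (m + 1)) s) : C.IsSum x (x 0 + s) := by
  intro r
  obtain ⟨N, hN⟩ := h r
  refine ⟨N + 1, fun m hm => ?_⟩
  obtain ⟨m, rfl⟩ := Nat.exists_eq_add_of_le' (show 1 ≤ m by omega)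
  have := hN m (by omega)
  beta_reduce at this ⊢
  rw [Finset.sum_range_succ']
  convert this using 1
  abel

lemma ad_apply (l : A 0) (x : A n) : C.ad l x = C.mul (zero_add n) l x - C.rmul x l := rfl

lemma ad_mem {l : A 0} {x : A n} {r s : ℕ} (hl : l ∈ C.fil s 0) (hx : x ∈ C.fil r n) :
    C.ad l x ∈ C.fil (r + s) n := by
  rw [ad_apply]
  refine Submodule.sub_mem _ ?_ (C.rmul_mem hx hl)
  rw [add_comm]
  exact C.mul_mem _ hl hx

lemma ad_pow_mem {l : A 0} {x : A n} {r : ℕ} (hl : l ∈ C.fil 1 0) (hx : x ∈ C.fil r n) (m : ℕ) :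
    (C.ad l ^ m) x ∈ C.fil (r + m) n := by
  induction m with
  | zero => exact hx
  | succ m ih =>
    rw [pow_succ', Module.End.mul_apply]
    exact C.ad_mem (r := r + m) hl ih

/-- The twisted differential `u ↦ (-1)^|u| u ⋆ α - du`. -/
def twist (α : A (-1)) {i j : ℤ} (h : j + 1 = i) (u : A i) : A j :=
  i.negOnePow • C.mul (by omega) u α - C.d h u

lemma twist_one (α : A (-1)) : C.twist α (by norm_num) C.one = α := by
  rw [twist, C.d_one, sub_zero, Int.negOnePow_zero, one_smul, C.one_mul]

lemma mul_rmul_sub {i j : ℤ} (h : i + -1 = j) (u : A i) (x : A 0) (γ : A (-1)) :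
    C.mul h (C.rmul u x) γ - C.rmul (C.mul h u γ) x = C.mul h u (C.ad x γ) := by
  have := C.preLie (add_zero i) h (zero_add (-1)) h h (add_zero j) (add_zero (-1)) u x γ
  simp only [zero_mul, Int.negOnePow_zero, one_smul] at this
  rw [ad_apply, map_sub]
  simp only [rmul]
  rw [sub_eq_sub_iff_add_eq_add] at this ⊢
  rw [add_comm, ← sub_eq_iff_eq_add] at this
  rw [← this]
  abel

/-- The pre-Lie identity turns the `α` part of the commutator into `u ⋆ ad_x α`, and the Leibniz
rule leaves only `u ⋆ dx` from the differential. -/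
lemma twist_rmul_sub (α : A (-1)) {i j : ℤ} (h : j + 1 = i) (u : A i) (x : A 0) :
    C.twist α h (C.rmul u x) - C.rmul (C.twist α h u) x =
      i.negOnePow • C.mul (by omega) u (C.ad x α - C.d (by norm_num) x) := by
  have h1 := C.d_mul (add_zero i) h (show (-1 : ℤ) + 1 = 0 by norm_num) h (add_zero j)
    (show i + -1 = j by omega) u x
  rw [map_sub, ← C.mul_rmul_sub, twist, twist, rmul_sub_left]
  have h2 : C.rmul (i.negOnePow • C.mul (show i + -1 = j by omega) u α) x =
      i.negOnePow • C.rmul (C.mul (show i + -1 = j by omega) u α) x := by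
    simp only [Units.smul_def, rmul, map_zsmul, LinearMap.smul_apply]
  rw [h2, rmul, h1, smul_sub, smul_sub]
  simp only [rmul]
  abel

/-- The iterated commutators of the twisted differential with the right multiplication by `x` are
given by these elements of degree `-1`. -/
def twistCoeff (x : A 0) (α : A (-1)) : ℕ → A (-1)
  | 0 => α
  | m + 1 => (C.ad x ^ m) (C.ad x α - C.d (by norm_num) x)

/-- The iterated commutators of the twisted differential with the right multiplication by `x`. -/
def twistIter (x : A 0) (α : A (-1)) {i j : ℤ} (h : j + 1 = i) (u : A i) : ℕ → A j
  | 0 => C.twist α h u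
  | m + 1 => i.negOnePow • C.mul (by omega) u (C.twistCoeff x α (m + 1))

lemma twistIter_rmul (x : A 0) (α : A (-1)) {i j : ℤ} (h : j + 1 = i) (u : A i) (m : ℕ) :
    C.twistIter x α h (C.rmul u x) m =
      C.rmul (C.twistIter x α h u m) x + C.twistIter x α h u (m + 1) := by
  rw [← sub_eq_iff_eq_add']
  rcases m with _ | m
  · exact C.twist_rmul_sub α h u x
  · have h2 : C.twistCoeff x α (m + 1 + 1) = C.ad x (C.twistCoeff x α (m + 1)) := by
      rw [twistCoeff, pow_succ', Module.End.mul_apply]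
      rfl
    rw [twistIter, twistIter, twistIter, h2, ← C.mul_rmul_sub, smul_sub]
    congr 1
    simp only [Units.smul_def, rmul, map_zsmul, LinearMap.smul_apply]

lemma twistIter_rmulIter (x : A 0) (α : A (-1)) {i j : ℤ} (h : j + 1 = i) (u : A i) (m : ℕ) :
    C.twist α h (C.rmulIter u x m) =
      ∑ p ∈ antidiagonal m, m.choose p.1 • C.rmulIter (C.twistIter x α h u p.2) x p.1 := by
  let R : Module.End k (ℕ → A j) := LinearMap.pi fun a => C.rmulLin j x ∘ₗ LinearMap.proj a
  let S : Module.End k (ℕ → A j) := LinearMap.pi fun a => LinearMap.proj (a + 1)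
  -- On sequences, passing from `u` to `u ⋆ x` acts as `R + S`, with `R` the termwise right
  -- multiplication and `S` the shift; the binomial theorem for commuting operators gives the
  -- formula.
  have hRS : Commute R S := rfl
  have hR : ∀ (p : ℕ) (w : ℕ → A j) (a : ℕ), (R ^ p) w a = C.rmulIter (w a) x p := by
    intro p w a
    induction p with
    | zero => rfl
    | succ p ih =>
      rw [pow_succ', Module.End.mul_apply, rmulIter, ← ih]
      rfl
  have hS : ∀ (p : ℕ) (w : ℕ → A j) (a : ℕ), (S ^ p) w a = w (a + p) := by
    intro p w
    induction p with
    | zero => exact fun _ => rfl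
    | succ p ih =>
      intro a
      rw [pow_succ', Module.End.mul_apply, show S ((S ^ p) w) a = (S ^ p) w (a + 1) from rfl, ih,
        add_assoc, add_comm 1]
  have h1 : C.twistIter x α h (C.rmulIter u x m) = ((R + S) ^ m) (C.twistIter x α h u) := by
    induction m with
    | zero => rfl
    | succ m ih =>
      rw [pow_succ', Module.End.mul_apply, ← ih]
      exact funext fun a => C.twistIter_rmul x α h _ a
  have h2 := congrFun h1 0
  rw [hRS.add_pow', LinearMap.sum_apply, Finset.sum_apply] at h2
  refine h2.trans (Finset.sum_congr rfl fun p _ => ?_)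
  rw [LinearMap.smul_apply, Pi.smul_apply, Module.End.mul_apply, hR, hS, zero_add]

lemma twistCoeff_mem {x : A 0} (hx : x ∈ C.fil 1 0) (α : A (-1)) (m : ℕ) :
    C.twistCoeff x α m ∈ C.fil m (-1) := by
  rcases m with _ | m
  · exact C.mem_fil_zero _
  · have h1 : C.ad x α ∈ C.fil 1 (-1) := by simpa using C.ad_mem hx (C.mem_fil_zero α)
    have h2 := C.ad_pow_mem hx
      (Submodule.sub_mem _ h1 (C.d_mem (show (-1 : ℤ) + 1 = 0 by norm_num) hx)) m
    rw [add_comm 1 m] at h2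
    exact h2

lemma units_smul_mem {r : ℕ} {v : A n} (e : ℤˣ) (hv : v ∈ C.fil r n) : e • v ∈ C.fil r n := by
  rw [Units.smul_def]
  exact zsmul_mem hv _

lemma twistIter_mem {x : A 0} (hx : x ∈ C.fil 1 0) (α : A (-1)) {i j : ℤ} (h : j + 1 = i)
    (u : A i) (m : ℕ) : C.twistIter x α h u m ∈ C.fil m j := by
  rcases m with _ | m
  · exact C.mem_fil_zero _
  · refine C.units_smul_mem _ ?_
    simpa using C.mul_mem (show i + -1 = j by omega) (C.mem_fil_zero u) (C.twistCoeff_mem hx α _)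

lemma rmulIter_neg (x : A n) (l : A 0) (m : ℕ) :
    C.rmulIter x (-l) m = (-1 : k) ^ m • C.rmulIter x l m := by
  induction m with
  | zero => simp [rmulIter]
  | succ m ih => rw [rmulIter, rmulIter, ih]; simp [rmul, pow_succ]

lemma isSum_gaugeAct {x : A 0} (hx : x ∈ C.fil 1 0) (α : A (-1)) :
    C.IsSum (fun m => (m ! : k)⁻¹ • C.twistCoeff x α m) (C.gaugeAct x α) := by
  have h1 := C.isSum_sum (x := fun m => (m ! : k)⁻¹ • (C.ad x ^ m) α) fun m =>
    Submodule.smul_mem _ _ (by simpa using C.ad_pow_mem hx (C.mem_fil_zero α) m)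
  have h2 := C.isSum_sum (x := fun m => ((m + 1)! : k)⁻¹ • (C.ad x ^ m)
    (C.d (show (-1 : ℤ) + 1 = 0 by norm_num) x)) fun m =>
    Submodule.smul_mem _ _ (by simpa using C.ad_pow_mem hx (C.mem_fil_zero _) m)
  -- A zero in front of the second series aligns `1 / (m + 1)!` with the term of index `m + 1` of
  -- the first.
  have h3 := IsSum.shift (C := C) (x := fun m => Nat.casesOn m 0 fun m =>
    ((m + 1)! : k)⁻¹ • (C.ad x ^ m) (C.d (show (-1 : ℤ) + 1 = 0 by norm_num) x)) h2
  have h4 := h1.sub h3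
  rw [gaugeAct]
  convert h4 using 1
  · funext m
    rcases m with _ | m
    · simp [twistCoeff]
    · simp only [twistCoeff]
      rw [map_sub, smul_sub, pow_succ, Module.End.mul_apply]
  · change _ = _ - (0 + _)
    rw [zero_add]

lemma isSum_twistIter {x : A 0} (hx : x ∈ C.fil 1 0) (α : A (-1)) {i j : ℤ} (h : j + 1 = i)
    (u : A i) : C.IsSum (fun m => (m ! : k)⁻¹ • C.twistIter x α h u m)
      (C.twist (C.gaugeAct x α) h u) := by
  have h1 := (C.isSum_gaugeAct hx α).map (i.negOnePow • C.mul (show i + -1 = j by omega) u)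
    fun r γ hγ => C.units_smul_mem _ (by simpa using C.mul_mem _ (C.mem_fil_zero u) hγ)
  have h2 := h1.sub (isSum_single (C := C) (x := fun m => if m = 0 then C.d h u else 0) 0
    fun j hj => if_neg hj)
  rw [if_pos rfl] at h2
  convert h2 using 1
  · funext m
    rcases m with _ | m
    · simp [twistIter, twist, twistCoeff, Units.smul_def]
    · simp [twistIter]
  · rfl

variable [CharZero k]

/-- Expanding the twisted differential of `u ⋆ x ⋯ ⋆ x` by iterated commutators splits `1 / m!` into
`1 / (a! b!)`. The sum over `b` is the differential twisted by the gauge transform, and the sum over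
`a` is the exponential. -/
lemma twist_rseries_exp {x : A 0} (hx : x ∈ C.fil 1 0) (α : A (-1)) {i j : ℤ} (h : j + 1 = i)
    (u : A i) : C.twist α h (C.rseries (PowerSeries.exp k) x u) =
      C.rseries (PowerSeries.exp k) x (C.twist (C.gaugeAct x α) h u) := by
  have h1 := (C.isSum_rseries (PowerSeries.exp k) hx u).map
    (i.negOnePow • (C.mul (show i + -1 = j by omega)).flip α - C.d h) fun r v hv =>
      Submodule.sub_mem _ (C.units_smul_mem _ (C.mul_mem (s := 0) _ hv (C.mem_fil_zero α)))
        (C.d_mem h hv)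
  refine h1.unique ?_
  have h2 := IsSum.antidiagonal (C := C)
    (b := fun a b => (a ! : k)⁻¹ • C.rmulIter ((b ! : k)⁻¹ • C.twistIter x α h u b) x a)
    (s := fun b => C.rseries (PowerSeries.exp k) x ((b ! : k)⁻¹ • C.twistIter x α h u b))
    (S := C.rseries (PowerSeries.exp k) x (C.twist (C.gaugeAct x α) h u))
    (fun a b => Submodule.smul_mem _ _ (by
      rw [add_comm]
      exact C.rmulIter_mem (Submodule.smul_mem _ _ (C.twistIter_mem hx α h u b)) hx a))
    (fun b => by
      simpa only [PowerSeries.coeff_exp_eq] using C.isSum_rseries (PowerSeries.exp k) hx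
        ((b ! : k)⁻¹ • C.twistIter x α h u b))
    ((C.isSum_twistIter hx α h u).map (C.rseriesLin j _ hx) fun r v hv => C.rseries_mem _ hx hv)
  convert h2 using 2 with m
  rw [PowerSeries.coeff_exp_eq, map_smul]
  change _ • C.twist α h _ = _
  rw [twistIter_rmulIter, Finset.smul_sum]
  refine Finset.sum_congr rfl fun p hp => ?_
  rw [rmulIter_eq, rmulIter_eq, map_smul, smul_smul, ← Nat.cast_smul_eq_nsmul k, smul_smul]
  congr 1
  rw [← mem_antidiagonal.1 hp, Nat.cast_add_choose]
  have := Nat.cast_ne_zero (R := k).2 (Nat.factorial_ne_zero (p.1 + p.2))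
  field_simp

/-! ### Consequences for the gauge action -/

lemma rseries_exp_neg {l : A 0} (hl : l ∈ C.fil 1 0) (v : A n) :
    C.rseries (PowerSeries.exp k) (-l) (C.rseries (PowerSeries.exp k) l v) = v := by
  have h : ∀ w : A n, C.rseries (PowerSeries.exp k) (-l) w =
      C.rseries (PowerSeries.evalNegHom (PowerSeries.exp k)) l w := by
    intro w
    simp only [rseries, rmulIter_neg, PowerSeries.evalNegHom, PowerSeries.coeff_rescale,
      smul_smul, mul_comm]
  rw [h, ← C.rseries_mul _ _ hl, mul_comm, PowerSeries.exp_mul_exp_neg_eq_one, C.rseries_one]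

lemma rseries_exp_injective {l : A 0} (hl : l ∈ C.fil 1 0) :
    Function.Injective (C.rseries (PowerSeries.exp k) l : A n → A n) :=
  Function.LeftInverse.injective (C.rseries_exp_neg hl)

lemma twist_exp {l : A 0} (hl : l ∈ C.fil 1 0) (α : A (-1)) :
    C.twist α (by norm_num) (C.exp l) = C.rseries (PowerSeries.exp k) l (C.gaugeAct l α) := by
  rw [exp_eq, C.twist_rseries_exp hl, twist_one]

lemma conjAct_exp {l : A 0} (hl : l ∈ C.fil 1 0) (α : A (-1)) :
    C.conjAct (C.exp l - C.one) (C.exp (-l) - C.one) α = C.gaugeAct l α := by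
  have hl' : -l ∈ C.fil 1 0 := Submodule.neg_mem _ hl
  rw [conjAct, C.circ_exp _ hl', C.circ_exp _ hl', ← C.rseriesLin_apply _ hl',
    ← C.rseriesLin_apply _ hl', ← map_sub, rseriesLin_apply, add_sub_cancel, map_sub, C.d_one,
    sub_zero, ← C.rseries_exp_neg hl (C.gaugeAct l α), ← twist_exp C hl, twist,
    Int.negOnePow_zero, one_smul]

lemma gaugeAct_zero (α : A (-1)) : C.gaugeAct 0 α = α := by
  have h := C.twist_exp (Submodule.zero_mem (C.fil 1 0)) α
  rwa [exp_eq, C.rseries_zero_right, C.rseries_zero_right, PowerSeries.coeff_exp_eq,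
    Nat.factorial_zero, Nat.cast_one, inv_one, one_smul, one_smul, twist_one, eq_comm] at h

/-- Moving `D_α` past `e^{R_y}` and then past `e^{R_x}` applies the transform by `y` first, so the
action is a left one. -/
lemma gaugeAct_bch (x y : C.fil 1 0) (α : A (-1)) :
    C.gaugeAct (C.bch x y) α = C.gaugeAct x (C.gaugeAct y α) := by
  have h := C.twist_exp (C.bch_mem x y) α
  rw [exp_eq, rseries_exp_bch, rseries_exp_bch, C.twist_rseries_exp y.2, ← exp_eq,
    C.twist_exp x.2] at h
  exact (C.rseries_exp_injective x.2 (C.rseries_exp_injective y.2 h)).symm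

lemma twist_twist (α : A (-1)) (u : A 0) :
    C.twist α (show (-2 : ℤ) + 1 = -1 by norm_num) (C.twist α (by norm_num) u) =
      -C.mul (zero_add (-2)) u (C.d (by norm_num) α + C.mul (by norm_num) α α) := by
  have h1 := C.preLie (show (0 : ℤ) + -1 = -1 by norm_num) (show (-1 : ℤ) + -1 = -2 by norm_num)
    (show (-1 : ℤ) + -1 = -2 by norm_num) (zero_add (-2)) (show (0 : ℤ) + -1 = -1 by norm_num)
    (show (-1 : ℤ) + -1 = -2 by norm_num) (show (-1 : ℤ) + -1 = -2 by norm_num) u α α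
  have h2 := C.d_mul (show (0 : ℤ) + -1 = -1 by norm_num) (show (-1 : ℤ) + 1 = 0 by norm_num)
    (show (-2 : ℤ) + 1 = -1 by norm_num) (show (-2 : ℤ) + 1 = -1 by norm_num)
    (show (-1 : ℤ) + -1 = -2 by norm_num) (zero_add (-2)) u α
  simp only [mul_neg, mul_one, neg_neg, Int.negOnePow_one, Int.negOnePow_zero, one_smul,
    Units.neg_smul] at h1 h2
  -- As `α` is odd, right symmetry makes the associator of `u, α, α` its own negative, hence zero.
  rw [eq_neg_iff_add_eq_zero, ← two_smul k, smul_eq_zero_iff_right two_ne_zero, sub_eq_zero] at h1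
  simp only [twist, Int.negOnePow_zero, one_smul, Int.negOnePow_neg, Int.negOnePow_one,
    Units.neg_smul, map_sub, map_add, LinearMap.sub_apply, h1, h2, C.d_d]
  abel

lemma gaugeAct_maurerCartan {l : A 0} (hl : l ∈ C.fil 1 0) {α : A (-1)}
    (hα : C.d (j := -2) (by norm_num) α + C.mul (by norm_num) α α = 0) :
    C.d (j := -2) (by norm_num) (C.gaugeAct l α) +
      C.mul (by norm_num) (C.gaugeAct l α) (C.gaugeAct l α) = 0 := by
  have h := C.twist_twist α (C.rseries (PowerSeries.exp k) l C.one)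
  rw [hα, map_zero, neg_zero, C.twist_rseries_exp hl, C.twist_rseries_exp hl, twist_twist,
    C.one_mul] at h
  have h0 : C.rseries (PowerSeries.exp k) l (0 : A (-2)) = 0 := map_zero (C.rseriesLin (-2) _ hl)
  rw [← h0] at h
  -- The square of the twisted differential vanishes at `exp(l)`; conjugation by the injective
  -- `e^{R_l}` carries this to the square for the new element at `1`, which is minus its
  -- Maurer–Cartan expression.
  exact neg_eq_zero.1 (C.rseries_exp_injective hl h)

end CompleteDGPreLieAlgebra

/-! ### Continuity for the filtration topology -/

namespace CompleteDGPreLieAlgebra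

variable {k : Type*} [Field k] {A : ℤ → Type*} [∀ n, AddCommGroup (A n)] [∀ n, Module k (A n)]
  (C : CompleteDGPreLieAlgebra k A) {n : ℤ}

lemma nhds_topology_hasBasis (x : A n) :
    (@nhds (A n) (C.topology n) x).HasBasis (fun _ : ℕ => True)
      (fun r => {y | y - x ∈ C.fil r n}) := by
  let := C.topology n
  refine ⟨fun s => ?_⟩
  rw [mem_nhds_iff]
  constructor
  · rintro ⟨U, hUs, hU, hx⟩
    obtain ⟨r, hr⟩ := hU x hx
    exact ⟨r, trivial, fun y hy => hUs (hr y hy)⟩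
  · rintro ⟨r, -, hr⟩
    refine ⟨{y | y - x ∈ C.fil r n}, hr, fun y hy => ⟨r, fun z hz => ?_⟩, ?_⟩
    · have := (C.fil r n).add_mem hz hy
      rwa [sub_add_sub_cancel] at this
    · change x - x ∈ C.fil r n
      simp

lemma nhds_induced_hasBasis {X : Type*} [t : TopologicalSpace X] {f : X → A n}
    (ht : t = (C.topology n).induced f) (x : X) :
    (nhds x).HasBasis (fun _ : ℕ => True) (fun r => {y | f y - f x ∈ C.fil r n}) := by
  subst ht
  let := C.topology n
  rw [nhds_induced]
  exact (C.nhds_topology_hasBasis (f x)).comap f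

variable {C} {n' n'' : ℤ} {X Y Z : Type*} [tX : TopologicalSpace X] [tY : TopologicalSpace Y]
  [tZ : TopologicalSpace Z] {f : X → A n} {g : Y → A n'} {h : Z → A n''}

lemma continuous_of_sub_mem (hX : tX = (C.topology n).induced f)
    (hY : tY = (C.topology n').induced g) {F : X → Y}
    (hF : ∀ r x x', f x - f x' ∈ C.fil r n → g (F x) - g (F x') ∈ C.fil r n') :
    Continuous F := by
  rw [continuous_iff_continuousAt]
  intro x
  refine ((C.nhds_induced_hasBasis hX x).tendsto_iff (C.nhds_induced_hasBasis hY (F x))).2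
    fun r _ => ⟨r, trivial, fun y hy => hF r y x hy⟩

lemma continuous_uncurry_of_sub_mem (hX : tX = (C.topology n).induced f)
    (hY : tY = (C.topology n').induced g) (hZ : tZ = (C.topology n'').induced h) {F : X → Y → Z}
    (hF : ∀ r x x' y y', f x - f x' ∈ C.fil r n → g y - g y' ∈ C.fil r n' →
      h (F x y) - h (F x' y') ∈ C.fil r n'') :
    Continuous fun p : X × Y => F p.1 p.2 := by
  rw [continuous_iff_continuousAt]
  rintro ⟨x, y⟩
  rw [ContinuousAt, nhds_prod_eq]
  refine (((C.nhds_induced_hasBasis hX x).prod (C.nhds_induced_hasBasis hY y)).tendsto_iff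
    (C.nhds_induced_hasBasis hZ (F x y))).2 fun r _ => ⟨(r, r), ⟨trivial, trivial⟩, ?_⟩
  rintro ⟨x', y'⟩ ⟨hx, hy⟩
  exact hF r _ _ _ _ hx hy

/-! ### The groups and the actions -/

variable (C)

lemma circ_sub_mem {x x' : A n} {y y' : A 0} (hy : y ∈ C.fil 1 0) (hy' : y' ∈ C.fil 1 0) {r : ℕ}
    (hx : x - x' ∈ C.fil r n) (hyy : y - y' ∈ C.fil r 0) :
    C.circ x y - C.circ x' y' ∈ C.fil r n :=
  (C.isSum_circ x hy).sub_mem (C.isSum_circ x' hy') fun m => by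
    rw [← smul_sub]
    exact Submodule.smul_mem _ _ (C.brace_sub_mem hx m fun _ => hyy)

lemma conjAct_sub_mem {l m l' m' : A 0} {α α' : A (-1)} (hm : m ∈ C.fil 1 0)
    (hm' : m' ∈ C.fil 1 0) {r : ℕ} (hl : l - l' ∈ C.fil r 0) (hmm : m - m' ∈ C.fil r 0)
    (hα : α - α' ∈ C.fil r (-1)) : C.conjAct l m α - C.conjAct l' m' α' ∈ C.fil r (-1) := by
  rw [conjAct, conjAct, sub_sub_sub_comm]
  refine Submodule.sub_mem _ (C.circ_sub_mem hm hm' ?_ hmm) (C.circ_sub_mem hm hm' ?_ hmm)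
  · have h : C.mul (zero_add (-1)) (C.one + l) α - C.mul (zero_add (-1)) (C.one + l') α' =
        C.mul (zero_add (-1)) (l - l') α + C.mul (zero_add (-1)) (C.one + l') (α - α') := by
      simp only [map_add, map_sub, LinearMap.add_apply, LinearMap.sub_apply]
      abel
    rw [h]
    refine Submodule.add_mem _ (C.mul_mem (s := 0) _ hl (C.mem_fil_zero _)) ?_
    simpa using C.mul_mem (zero_add (-1)) (C.mem_fil_zero (C.one + l')) hα
  · rw [← map_sub]
    exact C.d_mem _ hl

variable [CharZero k]

/-- The Magnus expansion of a group-like element, as an element of `F_1 A_0`. -/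
noncomputable def log (g : C.GroupLike) : C.fil 1 0 :=
  ⟨C.magnus (g.1 - C.one), C.magnus_mem g.2⟩

lemma exp_log (g : C.GroupLike) : C.exp (C.log g) = g.1 :=
  (C.exp_magnus g.2).trans (add_sub_cancel _ _)

/-- The exponential as a bijection from gauges to group-like elements. -/
noncomputable def expEquiv : C.Gauge ≃ C.GroupLike where
  toFun x := ⟨C.exp x.1, C.exp_sub_one_mem x.2⟩
  invFun := C.log
  left_inv x := Subtype.ext (C.magnus_exp_sub_one x.2)
  right_inv g := Subtype.ext (C.exp_log g)

lemma log_expEquiv (x : C.Gauge) : (C.log (C.expEquiv x) : A 0) = x.1 :=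
  C.magnus_exp_sub_one x.2

lemma circ_groupLike (v : A n) (g : C.GroupLike) :
    C.circ v (g.1 - C.one) = C.rseries (PowerSeries.exp k) (C.log g) v := by
  rw [← C.circ_exp v (C.log g).2, exp_log]

lemma exp_bch (x y : C.fil 1 0) : C.exp (C.bch x y) = C.circ (C.exp x) (C.exp y - C.one) := by
  rw [exp_eq, rseries_exp_bch, C.circ_exp _ y.2, ← exp_eq]

-- Defining the product through logarithms makes it land in `1 + F_1 A_0` at once; `exp_bch`
-- identifies it with `⊚`.
noncomputable local instance groupLikeMul : Mul C.GroupLike where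
  mul g h := C.expEquiv ⟨C.bch (C.log g) (C.log h), C.bch_mem _ _⟩

noncomputable local instance groupLikeOne : One C.GroupLike := ⟨⟨C.one, by simp⟩⟩

noncomputable local instance groupLikeInv : Inv C.GroupLike where
  inv g := C.expEquiv ⟨-C.log g, Submodule.neg_mem _ (C.log g).2⟩

lemma groupLike_mul_val (g h : C.GroupLike) : (g * h).1 = C.circ g.1 (h.1 - C.one) := by
  rw [← C.exp_log g, ← C.exp_log h]
  exact C.exp_bch _ _

lemma groupLike_inv_val (g : C.GroupLike) : (g⁻¹).1 = C.exp (-C.log g) := rfl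

lemma log_mul (g h : C.GroupLike) : (C.log (g * h) : A 0) = C.bch (C.log g) (C.log h) :=
  C.log_expEquiv _

lemma log_one : (C.log 1 : A 0) = 0 := by
  have h : C.exp 0 = C.one := by
    rw [exp_eq, C.rseries_zero_right, PowerSeries.coeff_exp_eq]
    simp
  have h' := C.magnus_exp_sub_one (Submodule.zero_mem (C.fil 1 0))
  rwa [h] at h'

noncomputable local instance groupLikeGroup : Group C.GroupLike :=
  Group.ofLeftAxioms
    -- Both bracketings apply `e^{R_{log h}}` and then `e^{R_{log l}}` to `g`.
    (fun g h l => Subtype.ext (by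
      rw [groupLike_mul_val, groupLike_mul_val, circ_groupLike, circ_groupLike, groupLike_mul_val,
        circ_groupLike, log_mul, rseries_exp_bch]))
    (fun g => Subtype.ext (by
      rw [groupLike_mul_val, circ_groupLike]
      exact (C.exp_eq _).symm.trans (C.exp_log g)))
    (fun g => Subtype.ext (by
      have h := C.rseries_exp_neg (Submodule.neg_mem _ (C.log g).2) C.one
      rw [groupLike_mul_val, circ_groupLike, groupLike_inv_val, exp_eq]
      rwa [neg_neg] at h))

noncomputable local instance gaugeGroup : Group C.Gauge := C.expEquiv.group

/-- The exponential as an isomorphism of groups. -/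
noncomputable def expMulEquiv : C.Gauge ≃* C.GroupLike where
  toEquiv := C.expEquiv
  map_mul' _ _ := C.expEquiv.apply_symm_apply _

lemma gauge_mul_val (x y : C.Gauge) : (x * y).1 = C.bch x y :=
  (C.log_mul _ _).trans (congrArg₂ C.bch (Subtype.ext (C.log_expEquiv x))
    (Subtype.ext (C.log_expEquiv y)))

lemma continuous_expEquiv : Continuous C.expEquiv :=
  continuous_of_sub_mem (C := C) (f := fun x : C.Gauge => x.1) (g := fun g : C.GroupLike => g.1)
    rfl rfl fun _ x x' h => C.exp_sub_mem x.2 x'.2 h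

lemma log_sub_mem {g g' : C.GroupLike} {r : ℕ} (h : g.1 - g'.1 ∈ C.fil r 0) :
    (C.log g - C.log g' : A 0) ∈ C.fil r 0 :=
  C.magnus_sub_mem g.2 g'.2 (by simpa using h)

lemma continuous_expEquiv_symm : Continuous C.expEquiv.symm :=
  continuous_of_sub_mem (C := C) (f := fun g : C.GroupLike => g.1) (g := fun x : C.Gauge => x.1)
    rfl rfl fun _ _ _ h => C.log_sub_mem h

lemma groupLike_inv_sub_mem {g g' : C.GroupLike} {r : ℕ} (h : g.1 - g'.1 ∈ C.fil r 0) :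
    (g⁻¹).1 - (g'⁻¹).1 ∈ C.fil r 0 := by
  refine C.exp_sub_mem (Submodule.neg_mem _ (C.log g).2) (Submodule.neg_mem _ (C.log g').2) ?_
  rw [neg_sub_neg, ← neg_sub]
  exact Submodule.neg_mem _ (C.log_sub_mem h)

lemma isTopologicalGroup_groupLike : IsTopologicalGroup C.GroupLike where
  continuous_mul := continuous_uncurry_of_sub_mem (C := C) (f := fun g : C.GroupLike => g.1)
    (g := fun g : C.GroupLike => g.1) (h := fun g : C.GroupLike => g.1) rfl rfl rfl
    fun r g g' h h' hg hh => by
      rw [groupLike_mul_val, groupLike_mul_val]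
      exact C.circ_sub_mem h.2 h'.2 hg (by simpa using hh)
  continuous_inv := continuous_of_sub_mem (C := C) (f := fun g : C.GroupLike => g.1)
    (g := fun g : C.GroupLike => g.1) rfl rfl fun _ _ _ h => C.groupLike_inv_sub_mem h

attribute [local instance] isTopologicalGroup_groupLike

lemma isTopologicalGroup_gauge : IsTopologicalGroup C.Gauge where
  continuous_mul := C.continuous_expEquiv_symm.comp
    ((C.continuous_expEquiv.comp continuous_fst).mul (C.continuous_expEquiv.comp continuous_snd))
  continuous_inv := C.continuous_expEquiv_symm.comp C.continuous_expEquiv.inv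

/-- The bridge between the two descriptions: the gauge form supplies the action axioms, the
conjugation form the continuity. -/
lemma conjAct_groupLike (g : C.GroupLike) (α : A (-1)) :
    C.conjAct (g.1 - C.one) (g⁻¹.1 - C.one) α = C.gaugeAct (C.log g) α := by
  rw [← C.conjAct_exp (C.log g).2, exp_log, groupLike_inv_val]

noncomputable local instance maurerCartanSMul : SMul C.GroupLike C.MaurerCartan where
  smul g α := ⟨C.conjAct (g.1 - C.one) (g⁻¹.1 - C.one) α.1, by
    rw [conjAct_groupLike]
    exact C.gaugeAct_maurerCartan (C.log g).2 α.2⟩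

lemma groupLike_smul_val (g : C.GroupLike) (α : C.MaurerCartan) :
    (g • α).1 = C.gaugeAct (C.log g) α.1 :=
  C.conjAct_groupLike g α.1

noncomputable local instance maurerCartanMulAction : MulAction C.GroupLike C.MaurerCartan where
  one_smul α := Subtype.ext (by rw [groupLike_smul_val, log_one, gaugeAct_zero])
  mul_smul g h α := Subtype.ext (by
    rw [groupLike_smul_val, groupLike_smul_val, groupLike_smul_val, log_mul, gaugeAct_bch])

lemma continuousSMul_maurerCartan : ContinuousSMul C.GroupLike C.MaurerCartan where
  continuous_smul := continuous_uncurry_of_sub_mem (C := C) (f := fun g : C.GroupLike => g.1)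
    (g := fun α : C.MaurerCartan => α.1) (h := fun α : C.MaurerCartan => α.1) rfl rfl rfl
    fun r g g' α α' hg hα =>
      C.conjAct_sub_mem g⁻¹.2 g'⁻¹.2 (by simpa using hg)
        (by simpa using C.groupLike_inv_sub_mem hg) hα

end CompleteDGPreLieAlgebra

theorem mainTheorem1 {k : Type*} [Field k] [CharZero k] {A : ℤ → Type*}
    [∀ n, AddCommGroup (A n)] [∀ n, Module k (A n)] (C : CompleteDGPreLieAlgebra k A) :
    -- the series `ln(exp(x) exp(y))` is a Lie series
    (∀ n, lieToAssoc k (bchLie k n) = bchAssoc k n) ∧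
    -- the gauge group and the deformation gauge group are (topological) groups
    ∃ (_ : Group C.Gauge) (_ : Group C.GroupLike),
      (∀ x y : C.Gauge, C.IsSum (C.bchTerm x y) (x * y).1 ∧ (x * y).1 = C.bch x y) ∧
      (1 : C.Gauge).1 = 0 ∧
      (∀ g h : C.GroupLike, (g * h).1 = C.circ g.1 (h.1 - C.one)) ∧
      (1 : C.GroupLike).1 = C.one ∧
      IsTopologicalGroup C.Gauge ∧ IsTopologicalGroup C.GroupLike ∧
      -- the exponential is an isomorphism between them, with inverse the Magnus expansion
      ∃ e : C.Gauge ≃* C.GroupLike,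
        (∀ x : C.Gauge, (e x).1 = C.exp x.1) ∧
        (∀ g : C.GroupLike, (e.symm g).1 = C.magnus (g.1 - C.one)) ∧
        Continuous e ∧ Continuous e.symm ∧
        -- the action on Maurer-Cartan elements
        ∃ _ : MulAction C.GroupLike C.MaurerCartan,
          (∀ (g : C.GroupLike) (α : C.MaurerCartan),
            (g • α).1 = C.conjAct (g.1 - C.one) (g⁻¹.1 - C.one) α.1) ∧
          (∀ (x : C.Gauge) (α : C.MaurerCartan), (e x • α).1 = C.gaugeAct x.1 α.1) ∧
          ContinuousSMul C.GroupLike C.MaurerCartan := by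
  refine ⟨lieToAssoc_bchLie k, C.gaugeGroup, C.groupLikeGroup,
    fun x y => ⟨?_, C.gauge_mul_val x y⟩, C.log_one, C.groupLike_mul_val, rfl,
    C.isTopologicalGroup_gauge, C.isTopologicalGroup_groupLike,
    C.expMulEquiv,
    fun _ => rfl, fun _ => rfl, C.continuous_expEquiv, C.continuous_expEquiv_symm,
    C.maurerCartanMulAction, fun _ _ => rfl, fun x α => ?_, C.continuousSMul_maurerCartan⟩
  · rw [C.gauge_mul_val]
    exact C.isSum_bch x y
  · exact (C.groupLike_smul_val _ _).trans (by rw [← C.log_expEquiv x]; rfl)
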